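/- All algebras are associative algebras over $\mathbb C$, not necessarily unital; a product is non degenerate if $ab=0$ for all $b$ implies $a=0$, and $ba=0$ for all $b$ implies $a=0$. The multiplier algebra $M(\mathscr A)$ is the unital algebra of pairs $m=(\lambda,\rho)$ of linear maps $\mathscr A\to\mathscr A$ with $\rho(a)b=a\lambda(b)$ for all $a,b$; one writes $ma=\lambda(a)$, $am=\rho(a)$, and the product is $(\lambda_1\lambda_2,\rho_2\rho_1)$. A multiplier Hopf algebra is a pair $(\mathscr A,\delta)$ of an algebra with non degenerate product and a homomorphism $\delta\colon\mathscr A\to M(\mathscr A\otimes\mathscr A)$ such that $T_1(a\otimes b)=\delta(a)(1\otimes b)$ and $T_2(a\otimes b)=(a\otimes 1)\delta(b)$ define bijections of $\mathscr A\otimes\mathscr A$ onto $\mathscr A\otimes\mathscr A\subset M(\mathscr A\otimes\mathscr A)$ and $T_2\otimes\mathrm{id}$ and $\mathrm{id}\otimes T_1$ commute on $\mathscr A\otimes\mathscr A\otimes\mathscr A$. It is regular if $(\mathscr A,\delta')$ is also a multiplier Hopf algebra, where $\delta'$ is $\delta$ followed by the flip. A linear functional $\varphi$ on $\mathscr A$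 is left invariant if $(\mathrm{id}\otimes\varphi)\delta(a)=\varphi(a)1$ in $M(\mathscr A)$ for all $a$, where $(\mathrm{id}\otimes\varphi)\delta(a)$ is the multiplier $b\mapsto(\mathrm{id}\otimes\varphi)(\delta(a)(b\otimes1))$, $b\mapsto(\mathrm{id}\otimes\varphi)((b\otimes1)\delta(a))$. For a linear functional $f$ on $\mathscr A$ and $a,b\in\mathscr A$ put $(af)(x)=f(xa)$ and $(fb)(x)=f(bx)$. The space $\mathscr A^{*}$ of reduced functionals is the linear span of all functionals $afb$. Reduced functionals extend to multipliers by $(afb)(m)=f(bma)$, and the convolution product on $\mathscr A^*$ is $(\xi_1\star\xi_2)(x)=(\xi_1\otimes\xi_2)(\delta(x))$, i.e. the bilinear operation with $(afb\star cgd)(x)=(f\otimes g)\bigl((b\otimes d)\,\delta(x)\,(a\otimes c)\bigr)$. **Proposition.** Let $(\mathscr A,\delta)$ be a regular multiplier Hopf algebra, let $\varphi\neq0$ be a left invariant functional on $\mathscr A$, and let $\widehat{\mathscr A}=\{a\varphi: a\in\mathscr A\}$. Then: 1. the convolution product is a well-defined bilinear operation $\mathscr A^*\times\mathscr A^*\to\mathscr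 A^*$, and it is associative; 2. $\widehat{\mathscr A}\subset\mathscr A^*$; 3. $\widehat{\mathscr A}$ is a two-sided ideal of $\mathscr A^*$: $\gamma\star\xi\in\widehat{\mathscr A}$ and $\xi\star\gamma\in\widehat{\mathscr A}$ for all $\gamma\in\mathscr A^*$, $\xi\in\widehat{\mathscr A}$; 4. the product of $\widehat{\mathscr A}$ given by convolution is non degenerate, and sending $\gamma\in\mathscr A^*$ to the multiplier $(\xi\mapsto\gamma\star\xi,\ \xi\mapsto\xi\star\gamma)$ of $\widehat{\mathscr A}$ is an injective algebra homomorphism $\mathscr A^*\to M(\widehat{\mathscr A})$. -/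

import Mathlib

open scoped TensorProduct

namespace MHopf

/-- The multiplier algebra (algebra of double centralizers) of a complex algebra, here a vector
space `V` with bilinear product `mul`: pairs `(lam, rho)` of linear maps `V → V` such that
`rho(a) b = a lam(b)` for all `a, b`.  A multiplier `m` has `lam(a) = m a` and `rho(a) = a m`;
accordingly the product is `(lam₁ ∘ lam₂, rho₂ ∘ rho₁)` and the unit is `(id, id)`. -/
def multiplierAlgebra {V : Type*} [AddCommGroup V] [Module ℂ V] (mul : V →ₗ[ℂ] V →ₗ[ℂ] V) :
    Subalgebra ℂ (Module.End ℂ V × (Module.End ℂ V)ᵐᵒᵖ) where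
  carrier := {m | ∀ a b : V, mul (m.2.unop a) b = mul a (m.1 b)}
  mul_mem' {m n} hm hn a b := by
    simp only [Set.mem_ofPred_eq] at hm hn
    simp [hm, hn]
  add_mem' {m n} hm hn a b := by
    simp only [Set.mem_ofPred_eq] at hm hn
    simp [hm, hn]
  algebraMap_mem' r a b := by
    simp [Prod.algebraMap_apply, MulOpposite.algebraMap_apply, Module.algebraMap_end_apply]

/-- The left multiplication `v ↦ m v` by a multiplier `m`. -/
def lam {V : Type*} [AddCommGroup V] [Module ℂ V] {mul : V →ₗ[ℂ] V →ₗ[ℂ] V}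
    (m : multiplierAlgebra mul) : V →ₗ[ℂ] V := m.1.1

/-- The right multiplication `v ↦ v m` by a multiplier `m`. -/
def rho {V : Type*} [AddCommGroup V] [Module ℂ V] {mul : V →ₗ[ℂ] V →ₗ[ℂ] V}
    (m : multiplierAlgebra mul) : V →ₗ[ℂ] V := m.1.2.unop

/-- A bilinear product is non degenerate if `a b = 0` for all `b` forces `a = 0`, and
`b a = 0` for all `b` forces `a = 0`. -/
def Nondegenerate {V : Type*} [AddCommGroup V] [Module ℂ V] (mul : V →ₗ[ℂ] V →ₗ[ℂ] V) : Prop :=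
  (∀ a, (∀ b, mul a b = 0) → a = 0) ∧ (∀ a, (∀ b, mul b a = 0) → a = 0)

section Algebras

variable {A : Type*} [NonUnitalRing A] [Module ℂ A] [SMulCommClass ℂ A A] [IsScalarTower ℂ A A]
variable {B : Type*} [NonUnitalRing B] [Module ℂ B] [SMulCommClass ℂ B B] [IsScalarTower ℂ B B]

/-- The multiplier algebra `M(A)` of an associative, possibly non-unital, complex algebra. -/
abbrev M (A : Type*) [NonUnitalRing A] [Module ℂ A] [SMulCommClass ℂ A A]
    [IsScalarTower ℂ A A] :
    Subalgebra ℂ (Module.End ℂ A × (Module.End ℂ A)ᵐᵒᵖ) :=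
  multiplierAlgebra (LinearMap.mul ℂ A)

/-- The canonical map `A → M(A)`. -/
def toM (a : A) : M A :=
  ⟨(LinearMap.mulLeft ℂ a, MulOpposite.op (LinearMap.mulRight ℂ a)), fun x y => by
    simp [mul_assoc]⟩

/-- For multipliers `m` of `B` and `n` of `A`, the multiplier `m ⊗ n` of `B ⊗ A`. -/
noncomputable def tmulM (m : M B) (n : M A) : M (B ⊗[ℂ] A) :=
  ⟨(TensorProduct.map (lam m) (lam n), MulOpposite.op (TensorProduct.map (rho m) (rho n))), by
    intro x y
    have hm : ∀ a b : B, rho m a * b = a * lam m b := m.2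
    have hn : ∀ a b : A, rho n a * b = a * lam n b := n.2
    induction x using TensorProduct.induction_on with
    | zero => simp
    | add x x' hx hx' =>
      simp only [MulOpposite.unop_op, LinearMap.mul_apply'] at hx hx' ⊢
      rw [map_add, add_mul, add_mul, hx, hx']
    | tmul b a =>
      induction y using TensorProduct.induction_on with
      | zero => simp
      | add y y' hy hy' =>
        simp only [MulOpposite.unop_op, LinearMap.mul_apply'] at hy hy' ⊢
        rw [map_add, mul_add, mul_add, hy, hy']
      | tmul b' a' => simp [hm, hn]⟩

/-- The flip `a ⊗ b ↦ b ⊗ a`, extended to `M(A ⊗ A)`: the multiplier `m` goes to the multiplier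
that acts as `m` does, conjugated by the flip. -/
noncomputable def flipM : M (A ⊗[ℂ] A) →ₐ[ℂ] M (A ⊗[ℂ] A) where
  toFun m :=
    ⟨((TensorProduct.comm ℂ A A).toLinearMap ∘ₗ lam m ∘ₗ (TensorProduct.comm ℂ A A).toLinearMap,
      MulOpposite.op ((TensorProduct.comm ℂ A A).toLinearMap ∘ₗ rho m ∘ₗ
        (TensorProduct.comm ℂ A A).toLinearMap)), by
      have hs : ∀ x y : A ⊗[ℂ] A, TensorProduct.comm ℂ A A (x * y) =
          TensorProduct.comm ℂ A A x * TensorProduct.comm ℂ A A y := by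
        intro x y
        induction x using TensorProduct.induction_on with
        | zero => simp
        | add x x' hx hx' => rw [add_mul, map_add, map_add, add_mul, hx, hx']
        | tmul b a =>
          induction y using TensorProduct.induction_on with
          | zero => simp
          | add y y' hy hy' => rw [mul_add, map_add, map_add, mul_add, hy, hy']
          | tmul b' a' => simp
      have hss : ∀ x : A ⊗[ℂ] A,
          TensorProduct.comm ℂ A A (TensorProduct.comm ℂ A A x) = x := fun x => by
        simp
      have hm : ∀ x y : A ⊗[ℂ] A, rho m x * y = x * lam m y := m.2
      intro x y
      have h := hm (TensorProduct.comm ℂ A A x) (TensorProduct.comm ℂ A A y)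
      have h' := congrArg (TensorProduct.comm ℂ A A) h
      rw [hs, hs, hss, hss] at h'
      exact h'⟩
  map_one' := by
    refine Subtype.ext (Prod.ext ?_ (MulOpposite.unop_injective ?_)) <;>
      refine TensorProduct.ext' fun a b => ?_ <;> simp [lam, rho]
  map_zero' := by
    refine Subtype.ext (Prod.ext ?_ (MulOpposite.unop_injective ?_)) <;>
      refine TensorProduct.ext' fun a b => ?_ <;> simp [lam, rho]
  map_add' m n := by
    refine Subtype.ext (Prod.ext ?_ (MulOpposite.unop_injective ?_)) <;>
      refine TensorProduct.ext' fun a b => ?_ <;> simp [lam, rho]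
  map_mul' m n := by
    have hss : ∀ x : A ⊗[ℂ] A,
        TensorProduct.comm ℂ A A (TensorProduct.comm ℂ A A x) = x := fun x => by
      simp
    refine Subtype.ext (Prod.ext ?_ (MulOpposite.unop_injective ?_)) <;>
      refine TensorProduct.ext' fun a b => ?_ <;> simp [lam, rho, hss]
  commutes' r := by
    refine Subtype.ext (Prod.ext ?_ (MulOpposite.unop_injective ?_)) <;>
      refine TensorProduct.ext' fun a b => ?_ <;>
      simp [lam, rho, Prod.algebraMap_apply, MulOpposite.algebraMap_apply,
        Module.algebraMap_end_apply]

/-- `(A, δ)` is a multiplier Hopf algebra: the product of `A` is non degenerate, the maps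
`T₁ : a ⊗ b ↦ δ(a)(1 ⊗ b)` and `T₂ : a ⊗ b ↦ (a ⊗ 1)δ(b)` are bijections of `A ⊗ A` onto
`A ⊗ A ⊆ M(A ⊗ A)`, and `T₂ ⊗ id` and `id ⊗ T₁` commute on `A ⊗ A ⊗ A` (coassociativity). -/
def IsMultiplierHopf (δ : A →ₙₐ[ℂ] M (A ⊗[ℂ] A)) : Prop :=
  Nondegenerate (LinearMap.mul ℂ A) ∧
  ∃ T₁ T₂ : (A ⊗[ℂ] A) ≃ₗ[ℂ] (A ⊗[ℂ] A),
    (∀ a b : A, toM (T₁ (a ⊗ₜ[ℂ] b)) = δ a * tmulM 1 (toM b)) ∧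
    (∀ a b : A, toM (T₂ (a ⊗ₜ[ℂ] b)) = tmulM (toM a) 1 * δ b) ∧
    ∀ z : A ⊗[ℂ] (A ⊗[ℂ] A),
      TensorProduct.assoc ℂ A A A (T₂.toLinearMap.rTensor A
        ((TensorProduct.assoc ℂ A A A).symm (T₁.toLinearMap.lTensor A z))) =
      T₁.toLinearMap.lTensor A (TensorProduct.assoc ℂ A A A (T₂.toLinearMap.rTensor A
        ((TensorProduct.assoc ℂ A A A).symm z)))

/-- `(A, δ)` is a regular multiplier Hopf algebra: both `(A, δ)` and `(A, δ')` are multiplier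
Hopf algebras, where `δ'` is `δ` followed by the flip. -/
def IsRegularMultiplierHopf (δ : A →ₙₐ[ℂ] M (A ⊗[ℂ] A)) : Prop :=
  IsMultiplierHopf δ ∧
  IsMultiplierHopf ((flipM : M (A ⊗[ℂ] A) →ₐ[ℂ] M (A ⊗[ℂ] A)).toNonUnitalAlgHom.comp δ)

/-- The multiplier `m` of `A` is the slice `(id ⊗ φ)(Y)`, for a functional `φ` and a multiplier
`Y` of `A ⊗ A` with `Y(b ⊗ 1)` and `(b ⊗ 1)Y` in `A ⊗ A` for all `b`:
`m b = (id ⊗ φ)(Y(b ⊗ 1))` and `b m = (id ⊗ φ)((b ⊗ 1)Y)`. -/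
def IsSlice (φ : Module.Dual ℂ A) (Y : M (A ⊗[ℂ] A)) (m : M A) : Prop :=
  ∀ b : A,
    (∃ t : A ⊗[ℂ] A, toM t = Y * tmulM (toM b) 1 ∧
      lam m b = TensorProduct.rid ℂ A (φ.lTensor A t)) ∧
    (∃ t : A ⊗[ℂ] A, toM t = tmulM (toM b) 1 * Y ∧
      rho m b = TensorProduct.rid ℂ A (φ.lTensor A t))

/-- `φ` is left invariant: `(id ⊗ φ)δ(a) = φ(a) 1` in `M(A)` for all `a`. -/
def IsLeftInvariant (δ : A →ₙₐ[ℂ] M (A ⊗[ℂ] A)) (φ : Module.Dual ℂ A) : Prop :=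
  ∀ a : A, IsSlice φ (δ a) (φ a • (1 : M A))

/-- The functional `a f : x ↦ f(x a)`. -/
def lact (a : A) (f : Module.Dual ℂ A) : Module.Dual ℂ A := f ∘ₗ LinearMap.mulRight ℂ a

/-- The functional `f b : x ↦ f(b x)`. -/
def ract (f : Module.Dual ℂ A) (b : A) : Module.Dual ℂ A := f ∘ₗ LinearMap.mulLeft ℂ b

variable (A) in
/-- The space `A^*` of reduced functionals: the linear span of the functionals `a f b`. -/
def reduced : Submodule ℂ (Module.Dual ℂ A) :=
  Submodule.span ℂ {ξ | ∃ (a b : A) (f : Module.Dual ℂ A), ξ = ract (lact a f) b}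

/-- The generator `a f b` of `A^*`. -/
def gen (a : A) (f : Module.Dual ℂ A) (b : A) : reduced A :=
  ⟨ract (lact a f) b, Submodule.subset_span ⟨a, b, f, rfl⟩⟩

/-- The element `b m a = (b m) a = b (m a)` of `A`, for `a, b` in `A` and a multiplier `m`. -/
def sandwich (b : A) (m : M A) (a : A) : A := rho m b * a

/-- `conv` is the convolution product `(ξ₁ ⋆ ξ₂)(x) = (ξ₁ ⊗ ξ₂)(δ(x))` of reduced functionals.
A reduced functional extends to multipliers by `(a f b)(m) = f(b m a)`, so, since
`(a f b) ⊗ (c g d) = (a ⊗ c)(f ⊗ g)(b ⊗ d)`, this means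
`((a f b) ⋆ (c g d))(x) = (f ⊗ g)((b ⊗ d) δ(x) (a ⊗ c))` on the spanning functionals. -/
def IsConvolution (δ : A →ₙₐ[ℂ] M (A ⊗[ℂ] A))
    (conv : reduced A →ₗ[ℂ] reduced A →ₗ[ℂ] reduced A) : Prop :=
  ∀ (a b c d : A) (f g : Module.Dual ℂ A) (x : A),
    (conv (gen a f b) (gen c g d) : Module.Dual ℂ A) x =
      TensorProduct.dualDistrib ℂ A A (f ⊗ₜ[ℂ] g)
        (sandwich (b ⊗ₜ[ℂ] d) (δ x) (a ⊗ₜ[ℂ] c))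

/-- The dual `{a φ : a ∈ A}`, a linear subspace of the space of all functionals. -/
def dualHat (φ : Module.Dual ℂ A) : Submodule ℂ (Module.Dual ℂ A) where
  carrier := {ξ | ∃ a : A, ξ = lact a φ}
  add_mem' := by
    rintro _ _ ⟨a, rfl⟩ ⟨b, rfl⟩
    exact ⟨a + b, by ext x; simp [lact, mul_add]⟩
  zero_mem' := ⟨0, by ext x; simp [lact]⟩
  smul_mem' := by
    rintro r _ ⟨a, rfl⟩
    exact ⟨r • a, by ext x; simp [lact, mul_smul_comm]⟩

end Algebras

end MHopf

set_option linter.unusedSectionVars false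

/-! Everything rests on the bijectivity of `T₁`, `T₂` and of `T₃ : a ⊗ b ↦ δ(a)(b ⊗ 1)`, the last
supplied by regularity. An identity is checked on elements of the form `T w`, where `δ`
multiplicative or `φ` invariant makes it immediate. Sweedler notation below stands for such
statements, each with enough factors to lie in `A` or `A ⊗ A`.

Convolution. For `u = (r ⊗ 1)δ(s)` and `v = δ(p)(1 ⊗ q)` one has `u δ(x) v = (r ⊗ 1)δ(s x p)(1 ⊗
q)`, so `x ↦ F(u δ(x) v)` is reduced (`coprodFunctional_mem`). Associativity is coassociativity
sliced by a functional (`rTensor_τ_T₁`). Writing `c ⊗ a = Σ δ(p)(q ⊗ 1)` and using left invariance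
gives `(c f b) ⋆ (a φ) = Σ f(b q) p φ`, the easy half of the ideal property. Surjectivity of `T₁`
and `T₃` makes the action on the dual faithful on either side.

The inclusion of the dual in the reduced functionals and the other half of the ideal property need
the counit `ε` and the antipode `S`, built from `T₁⁻¹` and `T₂⁻¹`. The pivot is `(φ ⊗ id)(T₂⁻¹(c ⊗
x)) = φ(c S(x₁)) x₂`, which also equals `c₁ φ(c₂ S(x))`. Pairing it with `φ` in both forms shows
that the functionals `φ(c S(·))` are exactly the `a φ` (`lact_mul_eq`). In the form `φ(c S(·))` the
dual is visibly stable under convolution from the right. A second invariance formula, `x₁ φ(y x₂) =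
S(y₁) φ(y₂ x)`, turns each `b φ` into some `φ b'` (`exists_ract_eq`). As `A` is spanned by products,
`(a₁ a₂)φ = a₁ φ b'` is then reduced. -/

namespace MHopf

/-! ### Leg-wise multiplications and slices on `A ⊗ A`. -/

section Legs

variable {A : Type*} [NonUnitalRing A] [Module ℂ A] [SMulCommClass ℂ A A] [IsScalarTower ℂ A A]

/-- Left multiplication by `a ⊗ 1`. -/
noncomputable def l₁ (a : A) : A ⊗[ℂ] A →ₗ[ℂ] A ⊗[ℂ] A := (LinearMap.mulLeft ℂ a).rTensor A

/-- Left multiplication by `1 ⊗ a`. -/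
noncomputable def l₂ (a : A) : A ⊗[ℂ] A →ₗ[ℂ] A ⊗[ℂ] A := (LinearMap.mulLeft ℂ a).lTensor A

/-- Right multiplication by `a ⊗ 1`. -/
noncomputable def r₁ (a : A) : A ⊗[ℂ] A →ₗ[ℂ] A ⊗[ℂ] A := (LinearMap.mulRight ℂ a).rTensor A

/-- Right multiplication by `1 ⊗ a`. -/
noncomputable def r₂ (a : A) : A ⊗[ℂ] A →ₗ[ℂ] A ⊗[ℂ] A := (LinearMap.mulRight ℂ a).lTensor A

/-- The slice `ω ⊗ id`. -/
noncomputable def sl (ω : Module.Dual ℂ A) : A ⊗[ℂ] A →ₗ[ℂ] A :=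
  (TensorProduct.lid ℂ A).toLinearMap ∘ₗ ω.rTensor A

/-- The slice `id ⊗ ω`. -/
noncomputable def sr (ω : Module.Dual ℂ A) : A ⊗[ℂ] A →ₗ[ℂ] A :=
  (TensorProduct.rid ℂ A).toLinearMap ∘ₗ ω.lTensor A

@[simp] lemma l₁_tmul (a b c : A) : l₁ a (b ⊗ₜ c) = (a * b) ⊗ₜ[ℂ] c := by simp [l₁]
@[simp] lemma l₂_tmul (a b c : A) : l₂ a (b ⊗ₜ c) = b ⊗ₜ[ℂ] (a * c) := by simp [l₂]
@[simp] lemma r₁_tmul (a b c : A) : r₁ a (b ⊗ₜ c) = (b * a) ⊗ₜ[ℂ] c := by simp [r₁]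
@[simp] lemma r₂_tmul (a b c : A) : r₂ a (b ⊗ₜ c) = b ⊗ₜ[ℂ] (c * a) := by simp [r₂]
@[simp] lemma sl_tmul (ω : Module.Dual ℂ A) (a b : A) : sl ω (a ⊗ₜ b) = ω a • b := by simp [sl]
@[simp] lemma sr_tmul (ω : Module.Dual ℂ A) (a b : A) : sr ω (a ⊗ₜ b) = ω b • a := by simp [sr]

@[simp] lemma lact_apply (a : A) (f : Module.Dual ℂ A) (x : A) : lact a f x = f (x * a) := rfl
@[simp] lemma ract_apply (f : Module.Dual ℂ A) (b x : A) : ract f b x = f (b * x) := rfl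

lemma apply_sl (ω f : Module.Dual ℂ A) (z : A ⊗[ℂ] A) : f (sl ω z) = ω (sr f z) := by
  induction z using TensorProduct.induction_on with
  | zero => simp
  | add x y hx hy => simp [hx, hy]
  | tmul a b => simp [mul_comm]

lemma sl_l₁ (ω : Module.Dual ℂ A) (a : A) (z : A ⊗[ℂ] A) : sl ω (l₁ a z) = sl (ract ω a) z := by
  induction z using TensorProduct.induction_on with
  | zero => simp
  | add x y hx hy => simp [hx, hy]
  | tmul b c => simp

lemma sl_r₁ (ω : Module.Dual ℂ A) (a : A) (z : A ⊗[ℂ] A) : sl ω (r₁ a z) = sl (lact a ω) z := by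
  induction z using TensorProduct.induction_on with
  | zero => simp
  | add x y hx hy => simp [hx, hy]
  | tmul b c => simp

lemma sl_l₂ (ω : Module.Dual ℂ A) (a : A) (z : A ⊗[ℂ] A) : sl ω (l₂ a z) = a * sl ω z := by
  induction z using TensorProduct.induction_on with
  | zero => simp
  | add x y hx hy => simp [hx, hy, mul_add]
  | tmul b c => simp [mul_smul_comm]

lemma sl_r₂ (ω : Module.Dual ℂ A) (a : A) (z : A ⊗[ℂ] A) : sl ω (r₂ a z) = sl ω z * a := by
  induction z using TensorProduct.induction_on with
  | zero => simp
  | add x y hx hy => simp [hx, hy, add_mul]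
  | tmul b c => simp [smul_mul_assoc]

lemma sr_l₁ (ω : Module.Dual ℂ A) (a : A) (z : A ⊗[ℂ] A) : sr ω (l₁ a z) = a * sr ω z := by
  induction z using TensorProduct.induction_on with
  | zero => simp
  | add x y hx hy => simp [hx, hy, mul_add]
  | tmul b c => simp [mul_smul_comm]

lemma sr_r₁ (ω : Module.Dual ℂ A) (a : A) (z : A ⊗[ℂ] A) : sr ω (r₁ a z) = sr ω z * a := by
  induction z using TensorProduct.induction_on with
  | zero => simp
  | add x y hx hy => simp [hx, hy, add_mul]
  | tmul b c => simp [smul_mul_assoc]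

lemma sr_l₂ (ω : Module.Dual ℂ A) (a : A) (z : A ⊗[ℂ] A) : sr ω (l₂ a z) = sr (ract ω a) z := by
  induction z using TensorProduct.induction_on with
  | zero => simp
  | add x y hx hy => simp [hx, hy]
  | tmul b c => simp

lemma tmul_mul_eq (a b : A) (z : A ⊗[ℂ] A) : (a ⊗ₜ[ℂ] b) * z = l₁ a (l₂ b z) := by
  induction z using TensorProduct.induction_on with
  | zero => simp
  | add x y hx hy => simp [hx, hy, mul_add]
  | tmul c d => simp

lemma mul_tmul_eq (a b : A) (z : A ⊗[ℂ] A) : z * (a ⊗ₜ[ℂ] b) = r₁ a (r₂ b z) := by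
  induction z using TensorProduct.induction_on with
  | zero => simp
  | add x y hx hy => simp [hx, hy, add_mul]
  | tmul c d => simp

lemma l₂_mul (a : A) (z w : A ⊗[ℂ] A) : l₂ a (z * w) = l₂ a z * w := by
  induction z using TensorProduct.induction_on with
  | zero => simp
  | add x y hx hy => simp [hx, hy, add_mul]
  | tmul c d =>
    induction w using TensorProduct.induction_on with
    | zero => simp
    | add x y hx hy => simp_all [mul_add]
    | tmul e f => simp [mul_assoc]

lemma mul_r₁ (a : A) (z w : A ⊗[ℂ] A) : r₁ a (z * w) = z * r₁ a w := by
  induction z using TensorProduct.induction_on with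
  | zero => simp
  | add x y hx hy => simp [hx, hy, add_mul]
  | tmul c d =>
    induction w using TensorProduct.induction_on with
    | zero => simp
    | add x y hx hy => simp_all [mul_add]
    | tmul e f => simp [mul_assoc]

lemma mul_r₂ (a : A) (z w : A ⊗[ℂ] A) : r₂ a (z * w) = z * r₂ a w := by
  induction z using TensorProduct.induction_on with
  | zero => simp
  | add x y hx hy => simp [hx, hy, add_mul]
  | tmul c d =>
    induction w using TensorProduct.induction_on with
    | zero => simp
    | add x y hx hy => simp_all [mul_add]
    | tmul e f => simp [mul_assoc]

lemma r₁_mul_eq (a : A) (z w : A ⊗[ℂ] A) : r₁ a z * w = z * l₁ a w := by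
  induction z using TensorProduct.induction_on with
  | zero => simp
  | add x y hx hy => simp [hx, hy, add_mul]
  | tmul c d =>
    induction w using TensorProduct.induction_on with
    | zero => simp
    | add x y hx hy => simp_all [mul_add]
    | tmul e f => simp [mul_assoc]

lemma l₁_l₂_comm (a b : A) (z : A ⊗[ℂ] A) : l₁ a (l₂ b z) = l₂ b (l₁ a z) := by
  induction z using TensorProduct.induction_on with
  | zero => simp
  | add x y hx hy => simp [hx, hy]
  | tmul c d => simp

lemma r₁_r₂_comm (a b : A) (z : A ⊗[ℂ] A) : r₁ a (r₂ b z) = r₂ b (r₁ a z) := by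
  induction z using TensorProduct.induction_on with
  | zero => simp
  | add x y hx hy => simp [hx, hy]
  | tmul c d => simp

lemma comm_mul (z w : A ⊗[ℂ] A) : TensorProduct.comm ℂ A A (z * w) =
    TensorProduct.comm ℂ A A z * TensorProduct.comm ℂ A A w := by
  induction z using TensorProduct.induction_on with
  | zero => simp
  | add x y hx hy => simp [hx, hy, add_mul]
  | tmul c d =>
    induction w using TensorProduct.induction_on with
    | zero => simp
    | add x y hx hy => simp_all [mul_add]
    | tmul e f => simp

/-- The coordinate functionals of a basis of `A` already separate tensors. -/
lemma eq_of_sl {B : Type*} [AddCommGroup B] [Module ℂ B] {z w : A ⊗[ℂ] B}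
    (h : ∀ ω : Module.Dual ℂ A, TensorProduct.lid ℂ B (ω.rTensor B z) =
      TensorProduct.lid ℂ B (ω.rTensor B w)) : z = w := by
  classical
  let 𝓑 := Module.Basis.ofVectorSpace ℂ A
  apply (TensorProduct.equivFinsuppOfBasisLeft (N := B) 𝓑).injective
  ext i
  rw [TensorProduct.equivFinsuppOfBasisLeft_apply, TensorProduct.equivFinsuppOfBasisLeft_apply]
  exact h _

lemma eq_of_sr {z w : A ⊗[ℂ] A} (h : ∀ ω : Module.Dual ℂ A, sr ω z = sr ω w) : z = w := by
  classical
  let 𝓑 := Module.Basis.ofVectorSpace ℂ A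
  apply (TensorProduct.equivFinsuppOfBasisRight (M := A) 𝓑).injective
  ext i
  rw [TensorProduct.equivFinsuppOfBasisRight_apply, TensorProduct.equivFinsuppOfBasisRight_apply]
  exact h _

lemma eq_of_sl' {z w : A ⊗[ℂ] A} (h : ∀ ω : Module.Dual ℂ A, sl ω z = sl ω w) : z = w :=
  eq_of_sl h

lemma sl_surjective {ω : Module.Dual ℂ A} (hω : ω ≠ 0) : Function.Surjective (sl ω) := by
  intro a
  obtain ⟨x, hx⟩ : ∃ x, ω x ≠ 0 := by
    by_contra! h
    exact hω (LinearMap.ext h)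
  exact ⟨((ω x)⁻¹ • x) ⊗ₜ a, by simp [hx]⟩


lemma Nondegenerate.right_cancel (nd : Nondegenerate (LinearMap.mul ℂ A)) {a a' : A}
    (h : ∀ c, a * c = a' * c) : a = a' :=
  sub_eq_zero.1 (nd.1 _ fun c => by simp [h c])

lemma Nondegenerate.left_cancel (nd : Nondegenerate (LinearMap.mul ℂ A)) {a a' : A}
    (h : ∀ c, c * a = c * a') : a = a' :=
  sub_eq_zero.1 (nd.2 _ fun c => by simp [mul_sub, h c])

lemma Nondegenerate.r₂_cancel (nd : Nondegenerate (LinearMap.mul ℂ A)) {z w : A ⊗[ℂ] A}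
    (h : ∀ c, r₂ c z = r₂ c w) : z = w :=
  eq_of_sl' fun ω => nd.right_cancel fun c => by rw [← sl_r₂, ← sl_r₂, h]

lemma Nondegenerate.mul_right_cancel (nd : Nondegenerate (LinearMap.mul ℂ A)) {z w : A ⊗[ℂ] A}
    (h : ∀ u, z * u = w * u) : z = w :=
  nd.r₂_cancel fun c => eq_of_sr fun ω => nd.right_cancel fun d => by
    rw [← sr_r₁, ← sr_r₁, ← mul_tmul_eq, ← mul_tmul_eq, h]

lemma Nondegenerate.mul_left_cancel (nd : Nondegenerate (LinearMap.mul ℂ A)) {z w : A ⊗[ℂ] A}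
    (h : ∀ u, u * z = u * w) : z = w := by
  refine eq_of_sl' fun ω => nd.left_cancel fun c => ?_
  rw [← sl_l₂, ← sl_l₂]
  congr 1
  refine eq_of_sr fun ω => nd.left_cancel fun d => ?_
  rw [← sr_l₁, ← sr_l₁, ← tmul_mul_eq, ← tmul_mul_eq, h]

end Legs

/-! ### Multipliers of a non degenerate algebra. -/

section Multipliers

variable {A : Type*} [NonUnitalRing A] [Module ℂ A] [SMulCommClass ℂ A A] [IsScalarTower ℂ A A]

@[simp] lemma lam_toM (a x : A) : lam (toM a) x = a * x := rfl
@[simp] lemma rho_toM (a x : A) : rho (toM a) x = x * a := rfl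
@[simp] lemma lam_mul (m n : M A) (x : A) : lam (m * n) x = lam m (lam n x) := rfl
@[simp] lemma rho_mul (m n : M A) (x : A) : rho (m * n) x = rho n (rho m x) := rfl
lemma rho_mul_eq (m : M A) (x y : A) : rho m x * y = x * lam m y := m.2 x y

/-- A double centralizer is not assumed to respect products; non degeneracy forces it, since both
sides agree after multiplication from the left. -/
lemma Nondegenerate.lam_apply_mul (nd : Nondegenerate (LinearMap.mul ℂ A)) (m : M (A ⊗[ℂ] A))
    (z w : A ⊗[ℂ] A) : lam m (z * w) = lam m z * w :=
  nd.mul_left_cancel fun u => by rw [← rho_mul_eq, ← mul_assoc, ← mul_assoc, rho_mul_eq]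

lemma Nondegenerate.rho_apply_mul (nd : Nondegenerate (LinearMap.mul ℂ A)) (m : M (A ⊗[ℂ] A))
    (z w : A ⊗[ℂ] A) : rho m (z * w) = z * rho m w :=
  nd.mul_right_cancel fun u => by rw [rho_mul_eq, mul_assoc, mul_assoc, rho_mul_eq]

lemma Nondegenerate.toM_injective (nd : Nondegenerate (LinearMap.mul ℂ A)) :
    Function.Injective (toM : A ⊗[ℂ] A → M (A ⊗[ℂ] A)) := fun z w h =>
  nd.mul_right_cancel fun u => by rw [← lam_toM, h, lam_toM]

end Multipliers

/-! ### The bijections `T₁`, `T₂`, `T₃` and how they interact. -/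

section Galois

variable {A : Type*} [NonUnitalRing A] [Module ℂ A] [SMulCommClass ℂ A A] [IsScalarTower ℂ A A]

/-- The bijections `T₁ : a ⊗ b ↦ δ(a)(1 ⊗ b)`, `T₂ : a ⊗ b ↦ (a ⊗ 1)δ(b)` and
`T₃ : a ⊗ b ↦ δ(a)(b ⊗ 1)` of a regular multiplier Hopf algebra. -/
structure GaloisMaps (δ : A →ₙₐ[ℂ] M (A ⊗[ℂ] A)) where
  T₁ : (A ⊗[ℂ] A) ≃ₗ[ℂ] (A ⊗[ℂ] A)
  T₂ : (A ⊗[ℂ] A) ≃ₗ[ℂ] (A ⊗[ℂ] A)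
  T₃ : (A ⊗[ℂ] A) ≃ₗ[ℂ] (A ⊗[ℂ] A)
  nd : Nondegenerate (LinearMap.mul ℂ A)
  toM_T₁ : ∀ a b : A, toM (T₁ (a ⊗ₜ[ℂ] b)) = δ a * tmulM 1 (toM b)
  toM_T₂ : ∀ a b : A, toM (T₂ (a ⊗ₜ[ℂ] b)) = tmulM (toM a) 1 * δ b
  toM_T₃ : ∀ a b : A, toM (T₃ (a ⊗ₜ[ℂ] b)) = δ a * tmulM (toM b) 1
  coassoc : ∀ z : A ⊗[ℂ] (A ⊗[ℂ] A),
    TensorProduct.assoc ℂ A A A (T₂.toLinearMap.rTensor A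
      ((TensorProduct.assoc ℂ A A A).symm (T₁.toLinearMap.lTensor A z))) =
    T₁.toLinearMap.lTensor A (TensorProduct.assoc ℂ A A A (T₂.toLinearMap.rTensor A
      ((TensorProduct.assoc ℂ A A A).symm z)))

theorem IsRegularMultiplierHopf.nonempty_galoisMaps {δ : A →ₙₐ[ℂ] M (A ⊗[ℂ] A)}
    (h : IsRegularMultiplierHopf δ) : Nonempty (GaloisMaps δ) := by
  obtain ⟨⟨nd, T₁, T₂, h₁, h₂, h₃⟩, -, T₁', -, h₁', -, -⟩ := h
  -- `T₃` is the first bijection of the flipped comultiplication, followed by the flip.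
  refine ⟨⟨T₁, T₂, T₁'.trans (TensorProduct.comm ℂ A A), nd, h₁, h₂, fun a b => ?_, h₃⟩⟩
  have hc : ∀ z : A ⊗[ℂ] A, l₂ b (TensorProduct.comm ℂ A A z) =
      TensorProduct.comm ℂ A A (l₁ b z) := fun z => by
    induction z using TensorProduct.induction_on with
    | zero => simp
    | add x y hx hy => simp [hx, hy]
    | tmul b c => simp
  have hc' : ∀ z : A ⊗[ℂ] A, TensorProduct.comm ℂ A A (r₂ b (TensorProduct.comm ℂ A A z)) =
      r₁ b z := fun z => by
    induction z using TensorProduct.induction_on with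
    | zero => simp
    | add x y hx hy => simp [hx, hy]
    | tmul b c => simp
  have hss : ∀ x : A ⊗[ℂ] A,
      TensorProduct.comm ℂ A A (TensorProduct.comm ℂ A A x) = x := fun x => by simp
  have e₁ : ∀ w, lam (toM (T₁' (a ⊗ₜ[ℂ] b))) w = TensorProduct.comm ℂ A A
      (lam (δ a) (TensorProduct.comm ℂ A A (l₂ b w))) := fun w => by rw [h₁']; rfl
  have e₂ : ∀ w, rho (toM (T₁' (a ⊗ₜ[ℂ] b))) w = r₂ b (TensorProduct.comm ℂ A A
      (rho (δ a) (TensorProduct.comm ℂ A A w))) := fun w => by rw [h₁']; rfl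
  have k₁ : ∀ w, lam (toM (TensorProduct.comm ℂ A A (T₁' (a ⊗ₜ[ℂ] b)))) w =
      lam (δ a * tmulM (toM b) 1) w := fun w => by
    have := congrArg (TensorProduct.comm ℂ A A) (e₁ (TensorProduct.comm ℂ A A w))
    rwa [lam_toM, comm_mul, hss, hss, hc, hss] at this
  have k₂ : ∀ w, rho (toM (TensorProduct.comm ℂ A A (T₁' (a ⊗ₜ[ℂ] b)))) w =
      rho (δ a * tmulM (toM b) 1) w := fun w => by
    have := congrArg (TensorProduct.comm ℂ A A) (e₂ (TensorProduct.comm ℂ A A w))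
    rwa [rho_toM, comm_mul, hss, hc'] at this
  exact Subtype.ext (Prod.ext (LinearMap.ext k₁)
    (MulOpposite.unop_injective (LinearMap.ext k₂)))

namespace GaloisMaps

variable {δ : A →ₙₐ[ℂ] M (A ⊗[ℂ] A)} (G : GaloisMaps δ)
include G

lemma T₁_mul (a b : A) (w : A ⊗[ℂ] A) : G.T₁ (a ⊗ₜ b) * w = lam (δ a) (l₂ b w) := by
  rw [← lam_toM, G.toM_T₁]; rfl

lemma mul_T₁ (a b : A) (w : A ⊗[ℂ] A) : w * G.T₁ (a ⊗ₜ b) = r₂ b (rho (δ a) w) := by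
  rw [← rho_toM, G.toM_T₁]; rfl

lemma T₂_mul (a b : A) (w : A ⊗[ℂ] A) : G.T₂ (a ⊗ₜ b) * w = l₁ a (lam (δ b) w) := by
  rw [← lam_toM, G.toM_T₂]; rfl

lemma mul_T₂ (a b : A) (w : A ⊗[ℂ] A) : w * G.T₂ (a ⊗ₜ b) = rho (δ b) (r₁ a w) := by
  rw [← rho_toM, G.toM_T₂]; rfl

lemma T₃_mul (a b : A) (w : A ⊗[ℂ] A) : G.T₃ (a ⊗ₜ b) * w = lam (δ a) (l₁ b w) := by
  rw [← lam_toM, G.toM_T₃]; rfl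

lemma mul_T₃ (a b : A) (w : A ⊗[ℂ] A) : w * G.T₃ (a ⊗ₜ b) = r₁ b (rho (δ a) w) := by
  rw [← rho_toM, G.toM_T₃]; rfl

lemma lam_tmul (a b c : A) : lam (δ a) (b ⊗ₜ c) = r₁ b (G.T₁ (a ⊗ₜ c)) :=
  G.nd.mul_left_cancel fun u => by
    rw [← mul_r₁, mul_T₁, ← rho_mul_eq, mul_tmul_eq]

lemma r₂_T₃ (a b c : A) : r₂ c (G.T₃ (a ⊗ₜ b)) = r₁ b (G.T₁ (a ⊗ₜ c)) := by
  rw [← lam_tmul]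
  refine G.nd.mul_left_cancel fun u => ?_
  rw [← mul_r₂, mul_T₃, ← rho_mul_eq, mul_tmul_eq, r₁_r₂_comm]

lemma rho_tmul (a b c : A) : rho (δ a) (b ⊗ₜ c) = l₂ c (G.T₂ (b ⊗ₜ a)) :=
  G.nd.mul_right_cancel fun u => by
    rw [← l₂_mul, T₂_mul, rho_mul_eq, tmul_mul_eq, l₁_l₂_comm]

/-- Both sides are `(a ⊗ 1)δ(b)(1 ⊗ c)`; this is the passage between `T₁` and `T₂`. -/
lemma l₁_T₁ (a b c : A) : l₁ a (G.T₁ (b ⊗ₜ c)) = r₂ c (G.T₂ (a ⊗ₜ b)) :=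
  G.nd.mul_left_cancel fun w => by
    rw [← mul_r₂, mul_T₂, ← r₁_mul_eq, mul_T₁]

lemma l₁_T₃ (a b c : A) : l₁ a (G.T₃ (b ⊗ₜ c)) = r₁ c (G.T₂ (a ⊗ₜ b)) :=
  G.nd.mul_left_cancel fun w => by
    rw [← mul_r₁, mul_T₂, ← r₁_mul_eq, mul_T₃]

lemma rho_T₂ (a b c : A) : rho (δ c) (G.T₂ (a ⊗ₜ b)) = G.T₂ (a ⊗ₜ (b * c)) :=
  G.nd.mul_left_cancel fun w => by
    rw [← G.nd.rho_apply_mul, mul_T₂, mul_T₂, map_mul, rho_mul]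

lemma lam_T₁ (a b c : A) : lam (δ a) (G.T₁ (b ⊗ₜ c)) = G.T₁ ((a * b) ⊗ₜ c) :=
  G.nd.mul_right_cancel fun w => by
    rw [← G.nd.lam_apply_mul, T₁_mul, T₁_mul, map_mul, lam_mul]

lemma lam_T₃ (a b c : A) : lam (δ a) (G.T₃ (b ⊗ₜ c)) = G.T₃ ((a * b) ⊗ₜ c) :=
  G.nd.mul_right_cancel fun w => by
    rw [← G.nd.lam_apply_mul, T₃_mul, T₃_mul, map_mul, lam_mul]

lemma sr_T₃_of_isLeftInvariant {φ : Module.Dual ℂ A} (hφ : IsLeftInvariant δ φ) (a b : A) :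
    sr φ (G.T₃ (a ⊗ₜ b)) = φ a • b := by
  obtain ⟨⟨t, ht, h⟩, -⟩ := hφ a b
  rw [← G.toM_T₃] at ht
  rw [← G.nd.toM_injective ht]
  exact h.symm

lemma sr_T₂_of_isLeftInvariant {φ : Module.Dual ℂ A} (hφ : IsLeftInvariant δ φ) (a b : A) :
    sr φ (G.T₂ (b ⊗ₜ a)) = φ a • b := by
  obtain ⟨-, ⟨t, ht, h⟩⟩ := hφ a b
  rw [← G.toM_T₂] at ht
  rw [← G.nd.toM_injective ht]
  exact h.symm

end GaloisMaps

end Galois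

/-! ### Reduced functionals. -/

section Reduced

variable {A : Type*} [NonUnitalRing A] [Module ℂ A] [SMulCommClass ℂ A A] [IsScalarTower ℂ A A]

lemma reduced_induction {p : reduced A → Prop} (hgen : ∀ a f b, p (gen a f b))
    (hzero : p 0) (hadd : ∀ ξ η, p ξ → p η → p (ξ + η)) (hsmul : ∀ (r : ℂ) ξ, p ξ → p (r • ξ))
    (ξ : reduced A) : p ξ := by
  obtain ⟨ξ, hξ⟩ := ξ
  induction hξ using Submodule.span_induction with
  | mem x h =>
    obtain ⟨a, b, f, rfl⟩ := h
    exact hgen a f b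
  | zero => exact hzero
  | add x y hx hy h₁ h₂ => exact hadd _ _ h₁ h₂
  | smul r x hx h => exact hsmul r _ h

lemma gen_apply (a b : A) (f : Module.Dual ℂ A) (x : A) :
    (gen a f b : Module.Dual ℂ A) x = f (b * x * a) := rfl

lemma reduced_hom_ext {V : Type*} [AddCommGroup V] [Module ℂ V] {F F' : reduced A →ₗ[ℂ] V}
    (h : ∀ a f b, F (gen a f b) = F' (gen a f b)) : F = F' := by
  ext ξ
  induction ξ using reduced_induction with
  | hgen a f b => exact h a f b
  | hzero => simp
  | hadd ξ η h₁ h₂ => simp [h₁, h₂]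
  | hsmul r ξ h => simp [h]

lemma sl_add (ω ω' : Module.Dual ℂ A) (z : A ⊗[ℂ] A) : sl (ω + ω') z = sl ω z + sl ω' z := by
  simp [sl, LinearMap.rTensor_add]

lemma sl_smul (r : ℂ) (ω : Module.Dual ℂ A) (z : A ⊗[ℂ] A) : sl (r • ω) z = r • sl ω z := by
  simp [sl, LinearMap.rTensor_smul]

lemma sl_zero (z : A ⊗[ℂ] A) : sl (0 : Module.Dual ℂ A) z = 0 := by
  simp [sl]

lemma sl_comp (ω : Module.Dual ℂ A) (τ : A →ₗ[ℂ] A) (z : A ⊗[ℂ] A) :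
    sl (ω ∘ₗ τ) z = sl ω (τ.rTensor A z) := by
  simp [sl, LinearMap.rTensor_comp]

lemma dualDistrib_eq (f g : Module.Dual ℂ A) (z : A ⊗[ℂ] A) :
    TensorProduct.dualDistrib ℂ A A (f ⊗ₜ[ℂ] g) z = g (sl f z) := by
  induction z using TensorProduct.induction_on with
  | zero => simp
  | add x y hx hy => simp only [map_add, hx, hy]
  | tmul a b => simp

end Reduced

namespace GaloisMaps

variable {A : Type*} [NonUnitalRing A] [Module ℂ A] [SMulCommClass ℂ A A] [IsScalarTower ℂ A A]
variable {δ : A →ₙₐ[ℂ] M (A ⊗[ℂ] A)} (G : GaloisMaps δ)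

/-- The operator `b ↦ (ω ⊗ id)((e ⊗ 1)δ(b))`. -/
noncomputable def τ (ω : Module.Dual ℂ A) (e : A) : A →ₗ[ℂ] A :=
  sl ω ∘ₗ G.T₂.toLinearMap ∘ₗ TensorProduct.mk ℂ A A e

lemma τ_apply (ω : Module.Dual ℂ A) (e b : A) : G.τ ω e b = sl ω (G.T₂ (e ⊗ₜ b)) := rfl

/-- Coassociativity, sliced in the first leg. -/
lemma rTensor_τ_T₁ (ω : Module.Dual ℂ A) (u : A) (z : A ⊗[ℂ] A) :
    (G.τ ω u).rTensor A (G.T₁ z) = G.T₁ ((G.τ ω u).rTensor A z) := by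
  induction z using TensorProduct.induction_on with
  | zero => simp
  | add x y hx hy => simp [hx, hy]
  | tmul q c =>
    have h := congrArg (fun t => TensorProduct.lid ℂ (A ⊗[ℂ] A) (ω.rTensor (A ⊗[ℂ] A) t))
      (G.coassoc (u ⊗ₜ (q ⊗ₜ c)))
    simp only [LinearMap.lTensor_tmul, TensorProduct.assoc_symm_tmul,
      LinearMap.rTensor_tmul, LinearEquiv.coe_coe] at h ⊢
    have h₁ : ∀ t : A ⊗[ℂ] A, TensorProduct.lid ℂ (A ⊗[ℂ] A) (ω.rTensor (A ⊗[ℂ] A)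
        (TensorProduct.assoc ℂ A A A (G.T₂.toLinearMap.rTensor A
          ((TensorProduct.assoc ℂ A A A).symm (u ⊗ₜ t))))) = (G.τ ω u).rTensor A t := fun t => by
      induction t using TensorProduct.induction_on with
      | zero => simp
      | add x y hx hy => simp only [TensorProduct.tmul_add, map_add, hx, hy]
      | tmul k l =>
        simp only [TensorProduct.assoc_symm_tmul, LinearMap.rTensor_tmul, τ_apply,
          LinearEquiv.coe_coe]
        generalize G.T₂ (u ⊗ₜ k) = s
        induction s using TensorProduct.induction_on with
        | zero => simp
        | add x y hx hy => simp only [TensorProduct.add_tmul, map_add, hx, hy]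
        | tmul k l => simp [TensorProduct.smul_tmul']
    have h₂ : ∀ s : A ⊗[ℂ] A, TensorProduct.lid ℂ (A ⊗[ℂ] A) (ω.rTensor (A ⊗[ℂ] A)
        (G.T₁.toLinearMap.lTensor A (TensorProduct.assoc ℂ A A A (s ⊗ₜ c)))) =
        G.T₁ (sl ω s ⊗ₜ c) := fun s => by
      induction s using TensorProduct.induction_on with
      | zero => simp
      | add x y hx hy => simp only [TensorProduct.add_tmul, map_add, hx, hy]
      | tmul k l => simp [← TensorProduct.smul_tmul']
    rw [← h₁, τ_apply, ← h₂]
    exact h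

/-! ### Convolution: existence, associativity, the left ideal property and faithfulness. -/

section Convolution

lemma dualDistrib_sandwich (f g : Module.Dual ℂ A) (a b c d x : A) :
    TensorProduct.dualDistrib ℂ A A (f ⊗ₜ[ℂ] g) (sandwich (b ⊗ₜ[ℂ] d) (δ x) (a ⊗ₜ[ℂ] c)) =
      g (d * sl (lact a f) (G.T₂ (b ⊗ₜ x)) * c) := by
  rw [dualDistrib_eq, sandwich, G.rho_tmul, mul_tmul_eq, sl_r₁, sl_r₂, sl_l₂]

lemma dualDistrib_sandwich' (f g : Module.Dual ℂ A) (a b c d x : A) :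
    TensorProduct.dualDistrib ℂ A A (f ⊗ₜ[ℂ] g) (sandwich (b ⊗ₜ[ℂ] d) (δ x) (a ⊗ₜ[ℂ] c)) =
      g (d * sl (ract (lact a f) b) (G.T₁ (x ⊗ₜ c))) := by
  rw [G.dualDistrib_sandwich, mul_assoc, ← sl_r₂, ← l₁_T₁, sl_l₁]

variable (δ) in
/-- The functional `x ↦ F(u δ(x) v)`. -/
noncomputable def coprodFunctional (F : Module.Dual ℂ (A ⊗[ℂ] A)) (u v : A ⊗[ℂ] A) :
    Module.Dual ℂ A where
  toFun x := F (rho (δ x) u * v)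
  map_add' x y := by
    have : rho (δ (x + y)) u = rho (δ x) u + rho (δ y) u := by rw [map_add]; rfl
    rw [this, add_mul, map_add]
  map_smul' r x := by
    have : rho (δ (r • x)) u = r • rho (δ x) u := by rw [map_smul]; rfl
    rw [this, smul_mul_assoc, map_smul]; rfl

include G in
lemma coprodFunctional_mem (F : Module.Dual ℂ (A ⊗[ℂ] A)) (u v : A ⊗[ℂ] A) :
    coprodFunctional δ F u v ∈ reduced A := by
  obtain ⟨u, rfl⟩ := G.T₂.surjective u
  obtain ⟨v, rfl⟩ := G.T₁.surjective v
  have add_left : ∀ u u' v, coprodFunctional δ F (u + u') v =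
      coprodFunctional δ F u v + coprodFunctional δ F u' v := fun u u' v => by
    ext x; simp [coprodFunctional, add_mul]
  have add_right : ∀ u v v', coprodFunctional δ F u (v + v') =
      coprodFunctional δ F u v + coprodFunctional δ F u v' := fun u v v' => by
    ext x; simp [coprodFunctional, mul_add]
  induction u using TensorProduct.induction_on with
  | zero =>
    convert (reduced A).zero_mem
    ext x; simp [coprodFunctional]
  | add x y hx hy => rw [map_add, add_left]; exact add_mem hx hy
  | tmul r s =>
    induction v using TensorProduct.induction_on with
    | zero =>
      convert (reduced A).zero_mem
      ext x; simp [coprodFunctional]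
    | add x y hx hy => rw [map_add, add_right]; exact add_mem hx hy
    | tmul p q =>
      let h : Module.Dual ℂ A := F ∘ₗ l₁ r ∘ₗ G.T₁.toLinearMap ∘ₗ (TensorProduct.mk ℂ A A).flip q
      convert (gen p h s).2
      ext x
      rw [gen_apply]
      change F _ = F (l₁ r (G.T₁ ((s * x * p) ⊗ₜ q)))
      -- `(r ⊗ 1)δ(s) · δ(x) · δ(p)(1 ⊗ q) = (r ⊗ 1)δ(s x p)(1 ⊗ q)`.
      rw [G.rho_T₂, G.T₂_mul, G.lam_T₁]

/-- The linear map `c ⊗ g ↦ c g`. -/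
noncomputable def lactHom : A ⊗[ℂ] Module.Dual ℂ A →ₗ[ℂ] Module.Dual ℂ A :=
  TensorProduct.lift (LinearMap.mk₂ ℂ lact
    (fun a b f => by ext x; simp [mul_add]) (fun r a f => by ext x; simp [mul_smul_comm])
    (fun a f g => by ext x; simp) (fun r a f => by ext x; simp))

/-- The map `ξ, c ⊗ g ↦ (x ↦ (ξ ⊗ g)(δ(x)(1 ⊗ c)))`. -/
noncomputable def preConv :
    Module.Dual ℂ A →ₗ[ℂ] A ⊗[ℂ] Module.Dual ℂ A →ₗ[ℂ] Module.Dual ℂ A where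
  toFun ξ := TensorProduct.lift (LinearMap.mk₂ ℂ
    (fun c g => g ∘ₗ sl ξ ∘ₗ G.T₁.toLinearMap ∘ₗ (TensorProduct.mk ℂ A A).flip c)
    (fun a b f => by ext x; simp) (fun r a f => by ext x; simp)
    (fun a f g => by ext x; simp) (fun r a f => by ext x; simp))
  map_add' ξ η := by
    refine TensorProduct.ext' fun c g => ?_
    ext x
    simp [sl_add]
  map_smul' r ξ := by
    refine TensorProduct.ext' fun c g => ?_
    ext x
    simp [sl_smul]

lemma preConv_tmul (ξ g : Module.Dual ℂ A) (c x : A) :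
    G.preConv ξ (c ⊗ₜ g) x = g (sl ξ (G.T₁ (x ⊗ₜ c))) := rfl

/-- When the first functional is `f b`, the value depends on `w` only through the functional it
represents. This makes convolution independent of how a reduced functional is written. -/
lemma preConv_ract (f : Module.Dual ℂ A) (b x : A) (w : A ⊗[ℂ] Module.Dual ℂ A) :
    G.preConv (ract f b) w x = lactHom w (sl f (G.T₂ (b ⊗ₜ x))) := by
  induction w using TensorProduct.induction_on with
  | zero => simp
  | add x y hx hy => simp [hx, hy]
  | tmul c g =>
    rw [preConv_tmul, ← sl_l₁, l₁_T₁, sl_r₂]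
    rfl

lemma mem_range_lactHom {ξ : Module.Dual ℂ A} (hξ : ξ ∈ reduced A) :
    ξ ∈ LinearMap.range (lactHom (A := A)) := by
  refine Submodule.span_le.2 ?_ hξ
  rintro _ ⟨a, b, f, rfl⟩
  exact ⟨a ⊗ₜ ract f b, by ext x; simp [lactHom, mul_assoc]⟩

include G in
theorem exists_isConvolution :
    ∃ conv : reduced A →ₗ[ℂ] reduced A →ₗ[ℂ] reduced A, IsConvolution δ conv := by
  -- A linear choice of representatives `Σ c ⊗ g` for functionals `Σ c g`; by `preConv_ract` the
  -- choice does not affect the result.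
  obtain ⟨s, hs⟩ := LinearMap.exists_rightInverse_of_surjective (lactHom (A := A)).rangeRestrict
    (LinearMap.range_rangeRestrict _)
  let ι : reduced A →ₗ[ℂ] LinearMap.range (lactHom (A := A)) :=
    Submodule.inclusion fun _ h => mem_range_lactHom h
  have hsι : ∀ η : reduced A, lactHom (s (ι η)) = (η : Module.Dual ℂ A) := fun η =>
    congrArg Subtype.val (LinearMap.congr_fun hs (ι η))
  let c₀ : reduced A →ₗ[ℂ] reduced A →ₗ[ℂ] Module.Dual ℂ A :=
    LinearMap.compl₁₂ G.preConv (reduced A).subtype (s ∘ₗ ι)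
  have hc : ∀ (a b : A) (f : Module.Dual ℂ A) (η : reduced A) (x : A), c₀ (gen a f b) η x =
      (η : Module.Dual ℂ A) (sl (lact a f) (G.T₂ (b ⊗ₜ x))) := fun a b f η x => by
    rw [← hsι η, ← preConv_ract]
    rfl
  have hc' : ∀ (a b c d : A) (f g : Module.Dual ℂ A) (x : A), c₀ (gen a f b) (gen c g d) x =
      TensorProduct.dualDistrib ℂ A A (f ⊗ₜ[ℂ] g)
        (sandwich (b ⊗ₜ[ℂ] d) (δ x) (a ⊗ₜ[ℂ] c)) := fun a b c d f g x => by
    rw [hc, G.dualDistrib_sandwich, gen_apply]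
  have hmem : ∀ ξ η, c₀ ξ η ∈ reduced A := fun ξ η => by
    induction ξ using reduced_induction with
    | hzero => simp
    | hadd ξ η h₁ h₂ => simpa using add_mem h₁ h₂
    | hsmul r ξ h => simpa using Submodule.smul_mem _ r h
    | hgen a f b =>
      induction η using reduced_induction with
      | hzero => simp
      | hadd ξ η h₁ h₂ => simpa using add_mem h₁ h₂
      | hsmul r ξ h => simpa using Submodule.smul_mem _ r h
      | hgen c g d =>
        convert G.coprodFunctional_mem (TensorProduct.dualDistrib ℂ A A (f ⊗ₜ[ℂ] g))
          (b ⊗ₜ[ℂ] d) (a ⊗ₜ[ℂ] c)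
        ext x
        exact hc' a b c d f g x
  refine ⟨LinearMap.mk₂ ℂ (fun ξ η => ⟨c₀ ξ η, hmem ξ η⟩) ?_ ?_ ?_ ?_, hc'⟩ <;>
    · intros
      ext1
      simp

theorem existsUnique_isConvolution (G : GaloisMaps δ) :
    ∃! conv : reduced A →ₗ[ℂ] reduced A →ₗ[ℂ] reduced A, IsConvolution δ conv := by
  obtain ⟨conv, h⟩ := G.exists_isConvolution
  refine ⟨conv, h, fun conv' h' => ?_⟩
  refine reduced_hom_ext fun a f b => reduced_hom_ext fun c g d => ?_
  ext x
  rw [h, h']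

variable {conv : reduced A →ₗ[ℂ] reduced A →ₗ[ℂ] reduced A} (hconv : IsConvolution δ conv)
include hconv

lemma conv_gen_left (a b : A) (f : Module.Dual ℂ A) (η : reduced A) (x : A) :
    (conv (gen a f b) η : Module.Dual ℂ A) x =
      (η : Module.Dual ℂ A) (G.τ (lact a f) b x) := by
  induction η using reduced_induction with
  | hgen c g d => rw [hconv, G.dualDistrib_sandwich, gen_apply, τ_apply]
  | hzero => simp
  | hadd ξ η h₁ h₂ => simp [h₁, h₂]
  | hsmul r ξ h => simp [h]

lemma conv_gen_right (ξ : reduced A) (c d : A) (g : Module.Dual ℂ A) (x : A) :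
    (conv ξ (gen c g d) : Module.Dual ℂ A) x = g (d * sl ξ (G.T₁ (x ⊗ₜ c))) := by
  induction ξ using reduced_induction with
  | hgen a f b => rw [hconv, G.dualDistrib_sandwich']; rfl
  | hzero => simp [sl_zero]
  | hadd ξ η h₁ h₂ => simp [h₁, h₂, sl_add, mul_add]
  | hsmul r ξ h => simp [h, sl_smul, mul_smul_comm]

lemma conv_lact_right (ξ η : reduced A) {c : A} {g : Module.Dual ℂ A}
    (hη : (η : Module.Dual ℂ A) = lact c g) (x : A) :
    (conv ξ η : Module.Dual ℂ A) x = g (sl ξ (G.T₁ (x ⊗ₜ c))) := by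
  induction ξ using reduced_induction with
  | hgen a f b =>
    rw [G.conv_gen_left hconv, hη, lact_apply, τ_apply, ← sl_r₂, ← l₁_T₁, sl_l₁]; rfl
  | hzero => simp [sl_zero]
  | hadd ξ η h₁ h₂ => simp [h₁, h₂, sl_add]
  | hsmul r ξ h => simp [h, sl_smul]

lemma conv_lact_left (ξ η : reduced A) {a : A} {g : Module.Dual ℂ A}
    (hξ : (ξ : Module.Dual ℂ A) = lact a g) (x : A) :
    (conv ξ η : Module.Dual ℂ A) x = (η : Module.Dual ℂ A) (sl g (G.T₃ (x ⊗ₜ a))) := by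
  induction η using reduced_induction with
  | hgen c h d =>
    rw [G.conv_gen_right hconv, gen_apply, mul_assoc, ← sl_r₂, G.r₂_T₃, sl_r₁, hξ]
  | hzero => simp
  | hadd ξ η h₁ h₂ => simp [h₁, h₂]
  | hsmul r ξ h => simp [h]

include G in
theorem conv_assoc (ξ η ζ : reduced A) : conv (conv ξ η) ζ = conv ξ (conv η ζ) := by
  induction ξ using reduced_induction with
  | hzero => simp
  | hadd ξ η h₁ h₂ => simp [h₁, h₂]
  | hsmul r ξ h => simp [h]
  | hgen a f b =>
    induction ζ using reduced_induction with
    | hzero => simp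
    | hadd ξ η h₁ h₂ => simp [h₁, h₂]
    | hsmul r ξ h => simp [h]
    | hgen c g d =>
      ext x
      have h : (conv (gen a f b) η : Module.Dual ℂ A) =
          (η : Module.Dual ℂ A) ∘ₗ G.τ (lact a f) b :=
        LinearMap.ext fun y => G.conv_gen_left hconv a b f η y
      -- Convolution by `a f b` on the left is composition with `τ`, and `τ ⊗ id` commutes with
      -- `T₁`.
      rw [G.conv_gen_right hconv, h, sl_comp, rTensor_τ_T₁, G.conv_gen_left hconv,
        G.conv_gen_right hconv, LinearMap.rTensor_tmul]

variable {φ : Module.Dual ℂ A} (hφ : IsLeftInvariant δ φ)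

include G hφ in
theorem conv_mem_dualHat_left (γ ξ : reduced A) (hξ : (ξ : Module.Dual ℂ A) ∈ dualHat φ) :
    (conv γ ξ : Module.Dual ℂ A) ∈ dualHat φ := by
  induction γ using reduced_induction with
  | hzero => simp
  | hadd ξ η h₁ h₂ => simpa using add_mem h₁ h₂
  | hsmul r ξ h => simpa using Submodule.smul_mem _ r h
  | hgen c f b =>
    obtain ⟨a, ha⟩ := hξ
    have key : ∀ w : A ⊗[ℂ] A, ∃ e, ∀ x, φ (sl f (G.T₂ (b ⊗ₜ x) * G.T₃ w)) = φ (x * e) := by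
      intro w
      induction w using TensorProduct.induction_on with
      | zero => exact ⟨0, by simp⟩
      | add u v hu hv =>
        obtain ⟨e, he⟩ := hu
        obtain ⟨e', he'⟩ := hv
        exact ⟨e + e', fun x => by simp [mul_add, he, he']⟩
      | tmul p q =>
        refine ⟨f (b * q) • p, fun x => ?_⟩
        rw [apply_sl, T₂_mul, lam_T₃, sr_l₁, G.sr_T₃_of_isLeftInvariant hφ]
        simp [mul_smul_comm, mul_comm]
    -- With `c ⊗ a = Σ δ(p)(q ⊗ 1)`, the value at `x` is `Σ (f ⊗ φ)((b ⊗ 1)δ(x p)(q ⊗ 1)) = Σ f(b q)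
    -- φ(x p)`.
    obtain ⟨w, hw⟩ := G.T₃.surjective (c ⊗ₜ a)
    obtain ⟨e, he⟩ := key w
    refine ⟨e, LinearMap.ext fun x => ?_⟩
    rw [G.conv_gen_left hconv, ha, lact_apply, lact_apply, ← he, hw, mul_tmul_eq, sl_r₁, sl_r₂,
      τ_apply]

include G in
-- `(γ ⋆ a φ)(x) = (γ ⊗ φ)(T₁(x ⊗ a))`, and `T₁` is onto, so `γ ⊗ φ = 0` with `φ ≠ 0`.
theorem eq_zero_of_conv_lact (hφ0 : φ ≠ 0) (h : dualHat φ ≤ reduced A) (γ : reduced A)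
    (hγ : ∀ ξ : dualHat φ, conv γ (Submodule.inclusion h ξ) = 0) : γ = 0 := by
  have h₁ : ∀ z, φ (sl γ (G.T₁ z)) = 0 := fun z => by
    induction z using TensorProduct.induction_on with
    | zero => simp
    | add x y hx hy => simp [hx, hy]
    | tmul x a =>
      rw [← G.conv_lact_right hconv γ (Submodule.inclusion h ⟨lact a φ, a, rfl⟩) rfl, hγ]
      rfl
  ext x
  obtain ⟨q, hq⟩ : ∃ q, φ q ≠ 0 := by
    by_contra! h
    exact hφ0 (LinearMap.ext h)
  obtain ⟨z, hz⟩ := G.T₁.surjective (x ⊗ₜ q)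
  simpa [hz, hq] using h₁ z

include G in
-- The same argument with `(a φ ⋆ γ)(x) = (φ ⊗ γ)(T₃(x ⊗ a))`.
theorem eq_zero_of_lact_conv (hφ0 : φ ≠ 0) (h : dualHat φ ≤ reduced A) (γ : reduced A)
    (hγ : ∀ ξ : dualHat φ, conv (Submodule.inclusion h ξ) γ = 0) : γ = 0 := by
  have h₁ : ∀ z, (γ : Module.Dual ℂ A) (sl φ (G.T₃ z)) = 0 := fun z => by
    induction z using TensorProduct.induction_on with
    | zero => simp
    | add x y hx hy => simp [hx, hy]
    | tmul x a =>
      rw [← G.conv_lact_left hconv (Submodule.inclusion h ⟨lact a φ, a, rfl⟩) γ rfl, hγ]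
      rfl
  ext x
  obtain ⟨z, hz⟩ := sl_surjective hφ0 x
  obtain ⟨z, rfl⟩ := G.T₃.surjective z
  rw [← hz, h₁]
  rfl

end Convolution

end GaloisMaps

/-! ### Slices and maps acting on one leg. -/

section Slices

variable {A : Type*} [NonUnitalRing A] [Module ℂ A] [SMulCommClass ℂ A A] [IsScalarTower ℂ A A]

lemma sl_lTensor (ω : Module.Dual ℂ A) (F : A →ₗ[ℂ] A) (z : A ⊗[ℂ] A) :
    sl ω (F.lTensor A z) = F (sl ω z) := by
  induction z using TensorProduct.induction_on with
  | zero => simp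
  | add x y hx hy => simp [hx, hy]
  | tmul a b => simp

lemma sr_rTensor (ω : Module.Dual ℂ A) (F : A →ₗ[ℂ] A) (z : A ⊗[ℂ] A) :
    sr ω (F.rTensor A z) = F (sr ω z) := by
  induction z using TensorProduct.induction_on with
  | zero => simp
  | add x y hx hy => simp [hx, hy]
  | tmul a b => simp

lemma rTensor_r₂ (F : A →ₗ[ℂ] A) (c : A) (z : A ⊗[ℂ] A) :
    F.rTensor A (r₂ c z) = r₂ c (F.rTensor A z) := by
  induction z using TensorProduct.induction_on with
  | zero => simp
  | add x y hx hy => simp [hx, hy]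
  | tmul a b => simp

lemma mul'_l₁ (a : A) (z : A ⊗[ℂ] A) :
    LinearMap.mul' ℂ A (l₁ a z) = a * LinearMap.mul' ℂ A z := by
  induction z using TensorProduct.induction_on with
  | zero => simp
  | add x y hx hy => simp [hx, hy, mul_add]
  | tmul b c => simp [mul_assoc]

lemma eq_of_dual {a b : A} (h : ∀ ω : Module.Dual ℂ A, ω a = ω b) : a = b :=
  sub_eq_zero.1 ((Module.forall_dual_apply_eq_zero_iff ℂ _).1 fun ω => by simp [h ω])

end Slices

namespace GaloisMaps

variable {A : Type*} [NonUnitalRing A] [Module ℂ A] [SMulCommClass ℂ A A] [IsScalarTower ℂ A A]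
variable {δ : A →ₙₐ[ℂ] M (A ⊗[ℂ] A)} (G : GaloisMaps δ)

/-! ### The counit. -/

section Counit

/-- `ε` is the counit: `(ε ⊗ id)(δ(a)(1 ⊗ b)) = a b`. -/
def IsCounit (ε : Module.Dual ℂ A) : Prop := ∀ z, sl ε (G.T₁ z) = LinearMap.mul' ℂ A z

lemma T₁_symm_τ_tmul (ω : Module.Dual ℂ A) (a b c : A) :
    G.T₁.symm (G.τ ω a b ⊗ₜ c) = (G.τ ω a).rTensor A (G.T₁.symm (b ⊗ₜ c)) := by
  apply G.T₁.injective
  rw [← rTensor_τ_T₁, LinearEquiv.apply_symm_apply, LinearEquiv.apply_symm_apply,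
    LinearMap.rTensor_tmul]

lemma mul'_T₁_symm_τ_tmul (ω : Module.Dual ℂ A) (a b c : A) :
    LinearMap.mul' ℂ A (G.T₁.symm (G.τ ω a b ⊗ₜ c)) = ω (a * b) • c := by
  have h : ∀ z : A ⊗[ℂ] A, LinearMap.mul' ℂ A ((G.τ ω a).rTensor A z) =
      sl ω (l₁ a (G.T₁ z)) := fun z => by
    induction z using TensorProduct.induction_on with
    | zero => simp
    | add x y hx hy => simp [hx, hy]
    | tmul p q => rw [l₁_T₁, sl_r₂, LinearMap.rTensor_tmul, LinearMap.mul'_apply, τ_apply]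
  rw [T₁_symm_τ_tmul, h, LinearEquiv.apply_symm_apply, l₁_tmul, sl_tmul]

/-- The product of `T₁⁻¹(a ⊗ c)` is a scalar multiple of `c`: this holds for `a = τ(b)` by
`mul'_T₁_symm_τ_tmul`, and such elements span `A` because `T₂` is onto. The scalar is `ε(a)`. -/
theorem exists_isCounit [Nontrivial A] : ∃ ε, G.IsCounit ε := by
  obtain ⟨c₀, hc₀⟩ := exists_ne (0 : A)
  obtain ⟨f, hf⟩ : ∃ f : Module.Dual ℂ A, f c₀ ≠ 0 := by
    by_contra! h
    exact hc₀ ((Module.forall_dual_apply_eq_zero_iff ℂ c₀).1 h)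
  have hf0 : f ≠ 0 := fun h => hf (by simp [h])
  have key : ∀ w : A ⊗[ℂ] A, ∃ s : ℂ, ∀ c,
      LinearMap.mul' ℂ A (G.T₁.symm (sl f (G.T₂ w) ⊗ₜ c)) = s • c := fun w => by
    induction w using TensorProduct.induction_on with
    | zero => exact ⟨0, by simp⟩
    | add x y hx hy =>
      obtain ⟨s, hs⟩ := hx
      obtain ⟨t, ht⟩ := hy
      exact ⟨s + t, fun c => by simp [TensorProduct.add_tmul, hs, ht, add_smul]⟩
    | tmul a b => exact ⟨f (a * b), fun c => G.mul'_T₁_symm_τ_tmul f a b c⟩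
  -- The scalar is read off at the single vector `c₀`, normalised by `f c₀ ≠ 0`, which makes it
  -- linear in `a`.
  let ε : Module.Dual ℂ A := (f c₀)⁻¹ • (f ∘ₗ LinearMap.mul' ℂ A ∘ₗ G.T₁.symm.toLinearMap ∘ₗ
    (TensorProduct.mk ℂ A A).flip c₀)
  have hε : ∀ a c, LinearMap.mul' ℂ A (G.T₁.symm (a ⊗ₜ c)) = ε a • c := fun a c => by
    obtain ⟨z, hz⟩ := sl_surjective hf0 a
    obtain ⟨w, rfl⟩ := G.T₂.surjective z
    obtain ⟨s, hs⟩ := key w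
    rw [hz] at hs
    have : ε a = s := by
      change (f c₀)⁻¹ • f (LinearMap.mul' ℂ A (G.T₁.symm (a ⊗ₜ c₀))) = s
      rw [hs]
      simp [mul_comm s, hf]
    rw [hs, this]
  refine ⟨ε, fun z => ?_⟩
  have : ∀ w : A ⊗[ℂ] A, sl ε w = LinearMap.mul' ℂ A (G.T₁.symm w) := fun w => by
    induction w using TensorProduct.induction_on with
    | zero => simp
    | add x y hx hy => simp [hx, hy]
    | tmul a c => rw [hε, sl_tmul]
  rw [this, LinearEquiv.symm_apply_apply]

variable {G} {ε : Module.Dual ℂ A} [Nontrivial A]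

lemma IsCounit.τ (hε : G.IsCounit ε) (ω : Module.Dual ℂ A) (a b : A) :
    ε (G.τ ω a b) = ω (a * b) := by
  obtain ⟨c, hc⟩ := exists_ne (0 : A)
  have := hε (G.T₁.symm (G.τ ω a b ⊗ₜ c))
  rw [mul'_T₁_symm_τ_tmul, LinearEquiv.apply_symm_apply, sl_tmul] at this
  exact smul_left_injective ℂ hc this

lemma IsCounit.sr_T₂ (hε : G.IsCounit ε) (z : A ⊗[ℂ] A) :
    sr ε (G.T₂ z) = LinearMap.mul' ℂ A z := by
  induction z using TensorProduct.induction_on with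
  | zero => simp
  | add x y hx hy => simp [hx, hy]
  | tmul a b =>
    refine eq_of_dual fun ω => ?_
    rw [← apply_sl, ← τ_apply, hε.τ, LinearMap.mul'_apply]

lemma IsCounit.ne_zero (hε : G.IsCounit ε) : ε ≠ 0 := by
  rintro rfl
  obtain ⟨a, ha⟩ := exists_ne (0 : A)
  refine ha (G.nd.1 a fun b => eq_of_dual fun ω => ?_)
  simpa using (hε.τ ω a b).symm

/-- Products span `A`, since `(ε ⊗ id) ∘ T₁` is onto. -/
lemma IsCounit.mul'_surjective (hε : G.IsCounit ε) :
    Function.Surjective (LinearMap.mul' ℂ A) := fun a => by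
  obtain ⟨z, hz⟩ := sl_surjective hε.ne_zero a
  obtain ⟨w, rfl⟩ := G.T₁.surjective z
  exact ⟨w, by rw [← hε, hz]⟩

/-- Apply `id ⊗ ε` to `(1 ⊗ e)T₂(d ⊗ c) = (d ⊗ e)δ(c)`: as `id ⊗ ε` turns right multiplication by
`δ(c)` into right multiplication by `c`, the factor `1 ⊗ e` contributes `ε(e)`. -/
lemma IsCounit.map_mul (hε : G.IsCounit ε) (a b : A) : ε (a * b) = ε a * ε b := by
  have h₁ : ∀ (c : A) (w : A ⊗[ℂ] A), sr ε (rho (δ c) w) = sr ε w * c := fun c w => by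
    obtain ⟨w, rfl⟩ := G.T₂.surjective w
    induction w using TensorProduct.induction_on with
    | zero => simp
    | add x y hx hy => simp [hx, hy, add_mul]
    | tmul p q => rw [G.rho_T₂, hε.sr_T₂, hε.sr_T₂]; simp [mul_assoc]
  have h₂ : ∀ (e : A) (z : A ⊗[ℂ] A), sr ε (l₂ e z) = ε e • sr ε z := fun e z => by
    obtain ⟨w, rfl⟩ := G.T₂.surjective z
    induction w using TensorProduct.induction_on with
    | zero => simp
    | add x y hx hy => simp [hx, hy]
    | tmul d c =>
      rw [← G.rho_tmul, h₁, sr_tmul, hε.sr_T₂, LinearMap.mul'_apply, smul_mul_assoc]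
  obtain ⟨k, hk⟩ := exists_ne (0 : A)
  have := h₂ a (k ⊗ₜ b)
  rw [l₂_tmul, sr_tmul, sr_tmul, smul_smul] at this
  exact smul_left_injective ℂ hk this

end Counit

/-! ### The antipode, through the products `a S(x)` and `S(x) c`. -/

section Antipode

/-- The map `a ⊗ x ↦ a S(x)`, where `S` is the antipode and `ε` the counit. -/
noncomputable def mulAntipode (ε : Module.Dual ℂ A) : A ⊗[ℂ] A →ₗ[ℂ] A :=
  sr ε ∘ₗ G.T₂.symm.toLinearMap

/-- The map `x ↦ S(x) c`, where `S` is the antipode and `ε` the counit. -/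
noncomputable def antipodeMul (ε : Module.Dual ℂ A) (c : A) : A →ₗ[ℂ] A :=
  sl ε ∘ₗ G.T₁.symm.toLinearMap ∘ₗ (TensorProduct.mk ℂ A A).flip c

lemma antipodeMul_apply (ε : Module.Dual ℂ A) (c x : A) :
    G.antipodeMul ε c x = sl ε (G.T₁.symm (x ⊗ₜ c)) := rfl

lemma mulAntipode_T₂ (ε : Module.Dual ℂ A) (w : A ⊗[ℂ] A) :
    G.mulAntipode ε (G.T₂ w) = sr ε w := by
  simp [mulAntipode]

variable {G} {ε : Module.Dual ℂ A} [Nontrivial A] (hε : G.IsCounit ε)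
include hε

/-- The two half-definitions of `S` agree: `a (S(z) c) = (a S(z)) c`. On `a ⊗ z = T₂(p ⊗ q)` both
sides are `ε(q) p c`. -/
lemma IsCounit.mul_antipodeMul (a c z : A) :
    a * G.antipodeMul ε c z = G.mulAntipode ε (a ⊗ₜ z) * c := by
  have h : ∀ w : A ⊗[ℂ] A, LinearMap.mul' ℂ A ((G.antipodeMul ε c).lTensor A (G.T₂ w)) =
      sr ε w * c := fun w => by
    induction w using TensorProduct.induction_on with
    | zero => simp
    | add x y hx hy => simp [hx, hy, add_mul]
    | tmul p q =>
      have : (G.antipodeMul ε c).lTensor A (G.T₂ (p ⊗ₜ q)) = l₁ p (G.T₁.symm (q ⊗ₜ c)) := by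
        refine eq_of_sl' fun ω => ?_
        have hτ : ε ∘ₗ G.τ ω p = ract ω p := LinearMap.ext (hε.τ ω p)
        rw [sl_lTensor, ← τ_apply, antipodeMul_apply, T₁_symm_τ_tmul, ← sl_comp, hτ, sl_l₁]
      rw [this, mul'_l₁, ← hε, LinearEquiv.apply_symm_apply]
      simp [mul_smul_comm, smul_mul_assoc]
  obtain ⟨w, hw⟩ := G.T₂.surjective (a ⊗ₜ z)
  rw [← hw, mulAntipode_T₂, ← h, hw]
  simp

/-- The antipode reverses products: `a S(d z) = (a S(z)) S(d)`. -/
lemma IsCounit.mulAntipode_tmul_mul (a d z : A) :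
    G.mulAntipode ε (a ⊗ₜ (d * z)) = G.mulAntipode ε (G.mulAntipode ε (a ⊗ₜ z) ⊗ₜ d) := by
  have h₁ : ∀ (q : A) (v : A ⊗[ℂ] A), G.mulAntipode ε (rho (δ q) v) =
      ε q • G.mulAntipode ε v := fun q v => by
    obtain ⟨v, rfl⟩ := G.T₂.surjective v
    induction v using TensorProduct.induction_on with
    | zero => simp
    | add x y hx hy => simp [hx, hy]
    | tmul r s =>
      rw [G.rho_T₂, mulAntipode_T₂, mulAntipode_T₂, sr_tmul, sr_tmul, hε.map_mul, smul_smul,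
        mul_comm]
  have h₂ : ∀ w : A ⊗[ℂ] A, G.mulAntipode ε (l₂ d (G.T₂ w)) =
      G.mulAntipode ε (sr ε w ⊗ₜ d) := fun w => by
    induction w using TensorProduct.induction_on with
    | zero => simp
    | add x y hx hy => simp [hx, hy, TensorProduct.add_tmul]
    | tmul p q => rw [← G.rho_tmul, h₁, sr_tmul, ← TensorProduct.smul_tmul', map_smul]
  obtain ⟨w, hw⟩ := G.T₂.surjective (a ⊗ₜ z)
  rw [← l₂_tmul, ← hw, h₂, mulAntipode_T₂]

/-- This says `T₂⁻¹(c ⊗ x) = c S(x₁) ⊗ x₂`; it follows by applying `a ⊗ z ↦ a S(z)` to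
coassociativity. -/
lemma IsCounit.rTensor_mulAntipode_T₁ (c x a : A) :
    (G.mulAntipode ε ∘ₗ TensorProduct.mk ℂ A A c).rTensor A (G.T₁ (x ⊗ₜ a)) =
      r₂ a (G.T₂.symm (c ⊗ₜ x)) := by
  have h₁ : ∀ (p : A) (t : A ⊗[ℂ] A), (G.mulAntipode ε).rTensor A (G.T₂.toLinearMap.rTensor A
      ((TensorProduct.assoc ℂ A A A).symm (p ⊗ₜ t))) = p ⊗ₜ sl ε t := fun p t => by
    induction t using TensorProduct.induction_on with
    | zero => simp
    | add x y hx hy => simp only [TensorProduct.tmul_add, map_add, hx, hy]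
    | tmul k l => simp [mulAntipode_T₂, TensorProduct.smul_tmul]
  have h₂ : ∀ w : A ⊗[ℂ] A, (G.mulAntipode ε).rTensor A ((TensorProduct.assoc ℂ A A A).symm
      (G.T₁.toLinearMap.lTensor A (TensorProduct.assoc ℂ A A A (G.T₂ w ⊗ₜ a)))) = r₂ a w := by
    intro w
    induction w using TensorProduct.induction_on with
    | zero => simp
    | add x y hx hy => simp only [TensorProduct.add_tmul, map_add, hx, hy]
    | tmul p q =>
      have h := G.coassoc (p ⊗ₜ (q ⊗ₜ a))
      simp only [TensorProduct.assoc_symm_tmul, LinearMap.rTensor_tmul,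
        LinearMap.lTensor_tmul, LinearEquiv.coe_coe] at h
      rw [← h, LinearEquiv.symm_apply_apply, h₁, hε, LinearMap.mul'_apply, r₂_tmul]
  have h₃ : ∀ t : A ⊗[ℂ] A, (G.mulAntipode ε).rTensor A
      ((TensorProduct.assoc ℂ A A A).symm (c ⊗ₜ t)) =
      (G.mulAntipode ε ∘ₗ TensorProduct.mk ℂ A A c).rTensor A t := fun t => by
    induction t using TensorProduct.induction_on with
    | zero => simp
    | add x y hx hy => simp only [TensorProduct.tmul_add, map_add, hx, hy]
    | tmul k l => simp
  have := h₂ (G.T₂.symm (c ⊗ₜ x))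
  rw [LinearEquiv.apply_symm_apply, TensorProduct.assoc_tmul, LinearMap.lTensor_tmul, h₃] at this
  exact this

omit hε [Nontrivial A] in
-- Both sides are `ω(e p₁ q₁) p₂ q₂ ⊗ q₃`.
lemma rTensor_τ_T₂ (G : GaloisMaps δ) (ω : Module.Dual ℂ A) (e p q : A) {ι : Type*}
    (s : Finset ι) (u v : ι → A) (h : G.T₂ (e ⊗ₜ p) = ∑ i ∈ s, u i ⊗ₜ v i) :
    (G.τ ω e).rTensor A (G.T₂ (p ⊗ₜ q)) = ∑ i ∈ s, G.T₂ (v i ⊗ₜ G.τ ω (u i) q) := by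
  have h₁ : G.τ ω e ∘ₗ LinearMap.mulLeft ℂ p =
      ∑ i ∈ s, LinearMap.mulLeft ℂ (v i) ∘ₗ G.τ ω (u i) := by
    ext k
    simp only [LinearMap.comp_apply, LinearMap.mulLeft_apply, LinearMap.sum_apply]
    rw [τ_apply, ← G.rho_T₂, h, map_sum, map_sum]
    refine Finset.sum_congr rfl fun i _ => ?_
    rw [G.rho_tmul, sl_l₂, τ_apply]
  refine G.nd.r₂_cancel fun c => ?_
  have h₂ : ∀ y : A ⊗[ℂ] A, (G.τ ω e).rTensor A (l₁ p y) =
      ∑ i ∈ s, l₁ (v i) ((G.τ ω (u i)).rTensor A y) := fun y => by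
    rw [l₁, ← LinearMap.rTensor_comp_apply, h₁]
    induction y using TensorProduct.induction_on with
    | zero => simp
    | add x y hx hy => simp only [map_add, hx, hy, Finset.sum_add_distrib]
    | tmul k l => simp [TensorProduct.sum_tmul]
  rw [← rTensor_r₂, ← l₁_T₁, h₂, map_sum]
  refine Finset.sum_congr rfl fun i _ => ?_
  rw [rTensor_τ_T₁, LinearMap.rTensor_tmul, l₁_T₁]

/-- In Sweedler form, `ω(e p₁ q₁) p₂ q₂ S(q₃) = ω(e p₁ q) p₂`. -/
lemma IsCounit.mulAntipode_rTensor_τ_T₂ (ω : Module.Dual ℂ A) (e p q : A) :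
    G.mulAntipode ε ((G.τ ω e).rTensor A (G.T₂ (p ⊗ₜ q))) = G.τ (lact q ω) e p := by
  obtain ⟨s, hs⟩ := TensorProduct.exists_finset (G.T₂ (e ⊗ₜ p))
  rw [G.rTensor_τ_T₂ ω e p q s (fun i => i.1) (fun i => i.2) hs, map_sum, τ_apply, hs, map_sum]
  refine Finset.sum_congr rfl fun i _ => ?_
  rw [mulAntipode_T₂, sr_tmul, hε.τ, sl_tmul, lact_apply]

end Antipode

end GaloisMaps

namespace GaloisMaps

variable {A : Type*} [NonUnitalRing A] [Module ℂ A] [SMulCommClass ℂ A A] [IsScalarTower ℂ A A]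
variable {δ : A →ₙₐ[ℂ] M (A ⊗[ℂ] A)} (G : GaloisMaps δ)

/-! ### Invariance of `φ` and the antipode; the right ideal property and the inclusion in the
reduced functionals. -/

section Integral

/-- The map `c ↦ (x ↦ φ(c S(x)))`, where `S` is the antipode and `ε` the counit. -/
noncomputable def antipodeFunctional (ε φ : Module.Dual ℂ A) : A →ₗ[ℂ] Module.Dual ℂ A :=
  (TensorProduct.mk ℂ A A).compr₂ (φ ∘ₗ G.mulAntipode ε)

lemma antipodeFunctional_apply (ε φ : Module.Dual ℂ A) (c x : A) :
    G.antipodeFunctional ε φ c x = φ (G.mulAntipode ε (c ⊗ₜ x)) := rfl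

/-- The element `(φ ⊗ id)(T₂⁻¹ z)`. -/
noncomputable def sliceInv (φ : Module.Dual ℂ A) : A ⊗[ℂ] A →ₗ[ℂ] A :=
  sl φ ∘ₗ G.T₂.symm.toLinearMap

lemma sliceInv_T₂ (φ : Module.Dual ℂ A) (w : A ⊗[ℂ] A) :
    G.sliceInv φ (G.T₂ w) = sl φ w := by
  simp [sliceInv]

variable {G} {φ : Module.Dual ℂ A} (hφ : IsLeftInvariant δ φ)
include hφ

/-- Strong left invariance. -/
lemma apply_sliceInv_mul (c x y : A) :
    φ (G.sliceInv φ (c ⊗ₜ x) * y) = φ (x * G.τ φ c y) := by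
  -- For `w = p ⊗ q`, invariance gives `φ(p) φ(q y) = (φ ⊗ φ)((p ⊗ 1)δ(q y))`.
  have h : ∀ w : A ⊗[ℂ] A, φ (sl φ w * y) = φ (sl φ (rho (δ y) (G.T₂ w))) := fun w => by
    induction w using TensorProduct.induction_on with
    | zero => simp
    | add u v hu hv => simp [hu, hv, add_mul]
    | tmul p q =>
      rw [G.rho_T₂, apply_sl, G.sr_T₂_of_isLeftInvariant hφ]
      simp [smul_mul_assoc, mul_comm]
  obtain ⟨w, hw⟩ := G.T₂.surjective (c ⊗ₜ x)
  rw [← hw, sliceInv_T₂, h, hw, G.rho_tmul, sl_l₂, τ_apply]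

variable {ε : Module.Dual ℂ A} [Nontrivial A] (hε : G.IsCounit ε)
include hε

/-- The identity `φ(c S(x₁)) x₂ = c₁ φ(c₂ S(x))`, multiplied by `e` on the left and paired with `ω`.
On `c ⊗ x = T₂(p ⊗ q)` invariance reduces both sides to `φ(p) ω(e q)`. -/
lemma IsCounit.apply_mul_sliceInv (ω : Module.Dual ℂ A) (e c x : A) :
    ω (e * G.sliceInv φ (c ⊗ₜ x)) = G.antipodeFunctional ε φ (G.τ ω e c) x := by
  have h : ∀ w : A ⊗[ℂ] A, ω (e * sl φ w) =
      φ (G.mulAntipode ε ((G.τ ω e).rTensor A (G.T₂ w))) := fun w => by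
    induction w using TensorProduct.induction_on with
    | zero => simp
    | add u v hu hv => simp [hu, hv, mul_add]
    | tmul p q =>
      rw [hε.mulAntipode_rTensor_τ_T₂, τ_apply, apply_sl, G.sr_T₂_of_isLeftInvariant hφ]
      simp [mul_smul_comm]
  obtain ⟨w, hw⟩ := G.T₂.surjective (c ⊗ₜ x)
  rw [← hw, sliceInv_T₂, h, hw, LinearMap.rTensor_tmul, antipodeFunctional_apply]

lemma IsCounit.apply_sliceInv_mul (ω : Module.Dual ℂ A) (e c x : A) :
    ω (G.sliceInv φ (c ⊗ₜ x) * e) =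
      G.antipodeFunctional ε φ (sl ω (G.T₃ (c ⊗ₜ e))) x := by
  let ξ : Module.Dual ℂ A := (G.antipodeFunctional ε φ).flip x
  have hξ : ∀ z, G.antipodeFunctional ε φ z x = ξ z := fun z => rfl
  have h : sr ξ (G.T₃ (c ⊗ₜ e)) = G.sliceInv φ (c ⊗ₜ x) * e := by
    refine G.nd.left_cancel fun d => eq_of_dual fun ω => ?_
    rw [← sr_l₁, l₁_T₃, sr_r₁, ← mul_assoc, ← lact_apply, ← lact_apply,
      hε.apply_mul_sliceInv hφ, hξ, τ_apply, apply_sl]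
  rw [← h, hξ, apply_sl]

omit hφ in
lemma IsCounit.sl_antipodeFunctional_T₁ (c x a : A) :
    sl (G.antipodeFunctional ε φ c) (G.T₁ (x ⊗ₜ a)) = G.sliceInv φ (c ⊗ₜ x) * a := by
  have h : G.antipodeFunctional ε φ c =
      φ ∘ₗ (G.mulAntipode ε ∘ₗ TensorProduct.mk ℂ A A c) := rfl
  rw [h, sl_comp, hε.rTensor_mulAntipode_T₁, sl_r₂]
  rfl

/-- Evaluate `φ(c S(x₁)) φ(x₂ e y)` in two ways. Strong invariance gives the left side, the identity
`φ(c S(x₁)) x₂ = c₁ φ(c₂ S(x))` the right. -/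
lemma IsCounit.lact_mul_eq (c e y : A) :
    lact (G.τ φ c (e * y)) φ =
      G.antipodeFunctional ε φ (sl (lact y φ) (G.T₃ (c ⊗ₜ e))) := by
  ext x
  rw [lact_apply, ← GaloisMaps.apply_sliceInv_mul hφ, ← mul_assoc, ← lact_apply,
    hε.apply_sliceInv_mul hφ]

lemma IsCounit.exists_antipodeFunctional_eq (hφ0 : φ ≠ 0) (b : A) :
    ∃ c, lact b φ = G.antipodeFunctional ε φ c := by
  have lact_add : ∀ a b : A, lact (a + b) φ = lact a φ + lact b φ := fun a b => by
    ext x; simp [mul_add]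
  obtain ⟨z, rfl⟩ := sl_surjective hφ0 b
  obtain ⟨w, rfl⟩ := G.T₂.surjective z
  induction w using TensorProduct.induction_on with
  | zero => exact ⟨0, by ext x; simp⟩
  | add u v hu hv =>
    obtain ⟨c, hc⟩ := hu
    obtain ⟨d, hd⟩ := hv
    exact ⟨c + d, by rw [map_add, map_add, map_add, lact_add, hc, hd]⟩
  | tmul c y =>
    obtain ⟨y, rfl⟩ := hε.mul'_surjective y
    rw [← τ_apply]
    induction y using TensorProduct.induction_on with
    | zero => exact ⟨0, by ext x; simp⟩
    | add u v hu hv =>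
      obtain ⟨c', hc⟩ := hu
      obtain ⟨d, hd⟩ := hv
      exact ⟨c' + d, by rw [map_add, map_add, map_add, lact_add, hc, hd]⟩
    | tmul e y => exact ⟨_, hε.lact_mul_eq hφ c e y⟩

lemma IsCounit.antipodeFunctional_mem_dualHat (hφ0 : φ ≠ 0) (c : A) :
    G.antipodeFunctional ε φ c ∈ dualHat φ := by
  -- Otherwise `φ` would vanish on products, which span `A`.
  obtain ⟨y, hy⟩ : ∃ y, lact y φ ≠ 0 := by
    by_contra! h
    refine hφ0 (LinearMap.ext fun a => ?_)
    obtain ⟨z, rfl⟩ := hε.mul'_surjective a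
    induction z using TensorProduct.induction_on with
    | zero => simp
    | add u v hu hv => simp only [map_add, hu, hv]
    | tmul a b => exact LinearMap.congr_fun (h b) a
  obtain ⟨z, rfl⟩ := sl_surjective hy c
  obtain ⟨w, rfl⟩ := G.T₃.surjective z
  induction w using TensorProduct.induction_on with
  | zero => simp
  | add u v hu hv => simpa using add_mem hu hv
  | tmul c e => exact ⟨_, (hε.lact_mul_eq hφ c e y).symm⟩

theorem IsCounit.conv_mem_dualHat_right
    {conv : reduced A →ₗ[ℂ] reduced A →ₗ[ℂ] reduced A} (hconv : IsConvolution δ conv)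
    (hφ0 : φ ≠ 0) (ξ γ : reduced A) (hξ : (ξ : Module.Dual ℂ A) ∈ dualHat φ) :
    (conv ξ γ : Module.Dual ℂ A) ∈ dualHat φ := by
  induction γ using reduced_induction with
  | hzero => simp
  | hadd ξ η h₁ h₂ => simpa using add_mem h₁ h₂
  | hsmul r ξ h => simpa using Submodule.smul_mem _ r h
  | hgen a g d =>
    obtain ⟨b, hb⟩ := hξ
    obtain ⟨c, hc⟩ := hε.exists_antipodeFunctional_eq hφ hφ0 b
    convert hε.antipodeFunctional_mem_dualHat hφ hφ0 (sl (ract g d) (G.T₃ (c ⊗ₜ a)))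
    ext x
    -- With `ξ = φ(c S(·))`, the value `(ξ ⋆ a g d)(x) = g(d φ(c S(x₁)) x₂ a)` is again of the form
    -- `φ(c' S(x))`.
    rw [G.conv_gen_right hconv, hb, hc, hε.sl_antipodeFunctional_T₁, ← ract_apply,
      hε.apply_sliceInv_mul hφ]

/-- The formula `x₁ φ(y x₂) = S(y₁) φ(y₂ x)`, multiplied on the right by `S(d) k`, which keeps all
terms inside `A`. -/
lemma IsCounit.sr_T₃_antipodeMul (d k x y : A) :
    sr (ract φ y) (G.T₃ (x ⊗ₜ G.antipodeMul ε k d)) =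
      sr (lact x φ) ((G.antipodeMul ε k).rTensor A (G.T₂ (d ⊗ₜ y))) := by
  refine G.nd.left_cancel fun a => ?_
  obtain ⟨w, hw⟩ := G.T₂.surjective (a ⊗ₜ y)
  have h₁ : ∀ w, sr φ (rho (δ x) (G.T₂ w)) = sr (lact x φ) w := fun w => by
    induction w using TensorProduct.induction_on with
    | zero => simp
    | add u v hu hv => simp [hu, hv]
    | tmul p q => rw [G.rho_T₂, G.sr_T₂_of_isLeftInvariant hφ, sr_tmul, lact_apply]
  let m := G.mulAntipode ε ∘ₗ TensorProduct.mk ℂ A A a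
  let m' := G.mulAntipode ε ∘ₗ (TensorProduct.mk ℂ A A).flip d
  have h₂ : m.rTensor A (G.T₂ (d ⊗ₜ y)) = m'.rTensor A w := by
    refine G.nd.r₂_cancel fun e => ?_
    have hm : m ∘ₗ LinearMap.mulLeft ℂ d = m' ∘ₗ m :=
      LinearMap.ext fun z => hε.mulAntipode_tmul_mul a d z
    rw [← rTensor_r₂, ← rTensor_r₂, ← l₁_T₁, l₁, ← LinearMap.rTensor_comp_apply, hm,
      LinearMap.rTensor_comp_apply, hε.rTensor_mulAntipode_T₁, ← hw,
      LinearEquiv.symm_apply_apply]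
  have h₃ : LinearMap.mulLeft ℂ a ∘ₗ G.antipodeMul ε k = LinearMap.mulRight ℂ k ∘ₗ m :=
    LinearMap.ext fun z => hε.mul_antipodeMul a k z
  rw [← sr_l₁, l₁_T₃, sr_r₁, ← sr_l₂, ← G.rho_tmul, ← hw, h₁, ← sr_l₁, l₁,
    ← LinearMap.rTensor_comp_apply, h₃, LinearMap.rTensor_comp_apply, h₂, sr_rTensor, sr_rTensor,
    hε.mul_antipodeMul]
  rfl

lemma IsCounit.exists_ract_eq (hφ0 : φ ≠ 0) (b : A) : ∃ b', lact b φ = ract φ b' := by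
  have ract_add : ∀ a b : A, ract φ (a + b) = ract φ a + ract φ b := fun a b => by
    ext x; simp [add_mul]
  have h₁ : ∀ y b : A, ∃ b', ∀ x, φ (sr (ract φ y) (G.T₃ (x ⊗ₜ b))) = φ (b' * x) := by
    intro y b
    -- Elements `S(d) k = (ε ⊗ id)(T₁⁻¹(d ⊗ k))` span `A`.
    obtain ⟨z, rfl⟩ := sl_surjective hε.ne_zero b
    obtain ⟨w, rfl⟩ := G.T₁.symm.surjective z
    induction w using TensorProduct.induction_on with
    | zero => exact ⟨0, by simp⟩
    | add u v hu hv =>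
      obtain ⟨b, hb⟩ := hu
      obtain ⟨c, hc⟩ := hv
      exact ⟨b + c, fun x => by simp [TensorProduct.tmul_add, hb, hc, add_mul]⟩
    | tmul d k =>
      refine ⟨sl φ ((G.antipodeMul ε k).rTensor A (G.T₂ (d ⊗ₜ y))), fun x => ?_⟩
      rw [← antipodeMul_apply, hε.sr_T₃_antipodeMul hφ, ← apply_sl, lact_apply]
  obtain ⟨c, hc⟩ := hε.exists_antipodeFunctional_eq hφ hφ0 b
  rw [hc]
  obtain ⟨z, rfl⟩ := sl_surjective hφ0 c
  obtain ⟨w, rfl⟩ := G.T₂.surjective z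
  clear hc
  induction w using TensorProduct.induction_on with
  | zero => exact ⟨0, by ext x; simp⟩
  | add u v hu hv =>
    obtain ⟨c, hc⟩ := hu
    obtain ⟨d, hd⟩ := hv
    exact ⟨c + d, by rw [map_add, map_add, map_add, ract_add, hc, hd]⟩
  | tmul y c =>
    obtain ⟨b, hb⟩ := hε.antipodeFunctional_mem_dualHat hφ hφ0 c
    obtain ⟨b', hb'⟩ := h₁ y b
    refine ⟨b', LinearMap.ext fun x => ?_⟩
    -- As `φ(c S(·)) = b φ`, the element `φ(c S(x₁)) x₂` equals `(φ ⊗ id)(δ(x)(b ⊗ 1))`.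
    have h : G.sliceInv φ (c ⊗ₜ x) = sl φ (G.T₃ (x ⊗ₜ b)) := G.nd.right_cancel fun a => by
      rw [← hε.sl_antipodeFunctional_T₁, hb, ← sl_r₁, ← r₂_T₃, sl_r₂]
    rw [← τ_apply, ← hε.apply_mul_sliceInv hφ, h, ract_apply, ← hb', ← apply_sl, ract_apply]

theorem IsCounit.dualHat_le_reduced (hφ0 : φ ≠ 0) : dualHat φ ≤ reduced A := by
  rintro _ ⟨a, rfl⟩
  obtain ⟨z, rfl⟩ := hε.mul'_surjective a
  induction z using TensorProduct.induction_on with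
  | zero =>
    convert (reduced A).zero_mem
    ext x; simp
  | add u v hu hv =>
    convert add_mem hu hv
    ext x; simp [mul_add]
  | tmul a₁ a₂ =>
    -- `φ(x a₁ a₂) = φ(b x a₁)`, so the functional is `a₁ φ b`.
    obtain ⟨b, hb⟩ := hε.exists_ract_eq hφ hφ0 a₂
    convert (gen a₁ φ b).2
    ext x
    rw [gen_apply, LinearMap.mul'_apply, lact_apply, ← mul_assoc, ← lact_apply, hb, ract_apply,
      mul_assoc]

end Integral

end GaloisMaps

end MHopf

/-! ### Assembly of the proposition. -/

theorem mainTheorem2 {A : Type*} [NonUnitalRing A] [Module ℂ A] [SMulCommClass ℂ A A]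
    [IsScalarTower ℂ A A] (δ : A →ₙₐ[ℂ] MHopf.M (A ⊗[ℂ] A))
    (hδ : MHopf.IsRegularMultiplierHopf δ)
    (φ : Module.Dual ℂ A) (hφ : MHopf.IsLeftInvariant δ φ) (hφ0 : φ ≠ 0) :
    -- the convolution product of reduced functionals is well defined
    (∃! conv : MHopf.reduced A →ₗ[ℂ] MHopf.reduced A →ₗ[ℂ] MHopf.reduced A,
      MHopf.IsConvolution δ conv) ∧
    -- the dual is contained in the space of reduced functionals
    ∃ h : MHopf.dualHat φ ≤ MHopf.reduced A,
    ∀ conv : MHopf.reduced A →ₗ[ℂ] MHopf.reduced A →ₗ[ℂ] MHopf.reduced A,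
      MHopf.IsConvolution δ conv →
      -- convolution is associative
      (∀ ξ η ζ : MHopf.reduced A, conv (conv ξ η) ζ = conv ξ (conv η ζ)) ∧
      -- the dual is a two-sided ideal
      (∀ (γ : MHopf.reduced A) (ξ : MHopf.dualHat φ),
        (conv γ (Submodule.inclusion h ξ) : Module.Dual ℂ A) ∈ MHopf.dualHat φ ∧
        (conv (Submodule.inclusion h ξ) γ : Module.Dual ℂ A) ∈ MHopf.dualHat φ) ∧
      -- convolution restricts to a non degenerate product on the dual, and acting on the dual by
      -- left and right convolution embeds the reduced functionals, as an algebra, into the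
      -- multiplier algebra of the dual
      ∃ mul : MHopf.dualHat φ →ₗ[ℂ] MHopf.dualHat φ →ₗ[ℂ] MHopf.dualHat φ,
        (∀ ξ η : MHopf.dualHat φ, Submodule.inclusion h (mul ξ η) =
          conv (Submodule.inclusion h ξ) (Submodule.inclusion h η)) ∧
        MHopf.Nondegenerate mul ∧
        ∃ Φ : MHopf.reduced A →ₗ[ℂ] MHopf.multiplierAlgebra mul,
          Function.Injective Φ ∧
          (∀ γ₁ γ₂ : MHopf.reduced A, Φ (conv γ₁ γ₂) = Φ γ₁ * Φ γ₂) ∧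
          ∀ (γ : MHopf.reduced A) (ξ : MHopf.dualHat φ),
            Submodule.inclusion h (MHopf.lam (Φ γ) ξ) = conv γ (Submodule.inclusion h ξ) ∧
            Submodule.inclusion h (MHopf.rho (Φ γ) ξ) = conv (Submodule.inclusion h ξ) γ := by
  obtain ⟨G⟩ := hδ.nonempty_galoisMaps
  have : Nontrivial A := by
    obtain ⟨x, hx⟩ : ∃ x, φ x ≠ 0 := by
      by_contra! h
      exact hφ0 (LinearMap.ext h)
    exact ⟨x, 0, fun h => hx (by simp [h])⟩
  obtain ⟨ε, hε⟩ := G.exists_isCounit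
  have h := hε.dualHat_le_reduced hφ hφ0
  refine ⟨G.existsUnique_isConvolution, h, fun conv hconv => ?_⟩
  have hassoc := G.conv_assoc hconv
  have hl : ∀ (γ : MHopf.reduced A) (ξ : MHopf.dualHat φ),
      (conv γ (Submodule.inclusion h ξ) : Module.Dual ℂ A) ∈ MHopf.dualHat φ := fun γ ξ =>
    G.conv_mem_dualHat_left hconv hφ γ _ ξ.2
  have hr : ∀ (γ : MHopf.reduced A) (ξ : MHopf.dualHat φ),
      (conv (Submodule.inclusion h ξ) γ : Module.Dual ℂ A) ∈ MHopf.dualHat φ := fun γ ξ =>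
    hε.conv_mem_dualHat_right hφ hconv hφ0 _ γ ξ.2
  let L : MHopf.reduced A →ₗ[ℂ] MHopf.dualHat φ →ₗ[ℂ] MHopf.dualHat φ :=
    LinearMap.mk₂ ℂ (fun γ ξ => ⟨_, hl γ ξ⟩) (by intros; ext1; simp) (by intros; ext1; simp)
      (by intros; ext1; simp) (by intros; ext1; simp)
  let R : MHopf.reduced A →ₗ[ℂ] MHopf.dualHat φ →ₗ[ℂ] MHopf.dualHat φ :=
    LinearMap.mk₂ ℂ (fun γ ξ => ⟨_, hr γ ξ⟩) (by intros; ext1; simp) (by intros; ext1; simp)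
      (by intros; ext1; simp) (by intros; ext1; simp)
  have hL : ∀ γ ξ, Submodule.inclusion h (L γ ξ) = conv γ (Submodule.inclusion h ξ) :=
    fun _ _ => rfl
  have hR : ∀ γ ξ, Submodule.inclusion h (R γ ξ) = conv (Submodule.inclusion h ξ) γ :=
    fun _ _ => rfl
  have hinj := Submodule.inclusion_injective h
  let mul := L ∘ₗ Submodule.inclusion h
  have hmul : ∀ ξ η, Submodule.inclusion h (mul ξ η) =
      conv (Submodule.inclusion h ξ) (Submodule.inclusion h η) := fun _ _ => rfl
  refine ⟨hassoc, fun γ ξ => ⟨hl γ ξ, hr γ ξ⟩, mul, hmul, ⟨fun ξ hξ => ?_, fun ξ hξ => ?_⟩, ?_⟩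
  · apply hinj
    rw [map_zero]
    refine G.eq_zero_of_conv_lact hconv hφ0 h _ fun η => ?_
    rw [← hmul, hξ, map_zero]
  · apply hinj
    rw [map_zero]
    refine G.eq_zero_of_lact_conv hconv hφ0 h _ fun η => ?_
    rw [← hmul, hξ, map_zero]
  -- The multiplier condition `(ξ ⋆ γ) ⋆ η = ξ ⋆ (γ ⋆ η)` is associativity.
  let Φ : MHopf.reduced A →ₗ[ℂ] MHopf.multiplierAlgebra mul :=
    { toFun := fun γ => ⟨(L γ, MulOpposite.op (R γ)), fun ξ η => by
        apply hinj
        change Submodule.inclusion h (mul (R γ ξ) η) = Submodule.inclusion h (mul ξ (L γ η))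
        rw [hmul, hmul, hL, hR, hassoc]⟩
      map_add' := fun γ γ' => Subtype.ext (Prod.ext (map_add L γ γ')
        (MulOpposite.unop_injective (map_add R γ γ')))
      map_smul' := fun r γ => Subtype.ext (Prod.ext (map_smul L r γ)
        (MulOpposite.unop_injective (map_smul R r γ))) }
  have hΦ : ∀ γ ξ, MHopf.lam (Φ γ) ξ = L γ ξ := fun _ _ => rfl
  refine ⟨Φ, ?_, fun γ₁ γ₂ => ?_, fun γ ξ => ⟨hL γ ξ, hR γ ξ⟩⟩
  · rw [injective_iff_map_eq_zero]
    intro γ hγ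
    refine G.eq_zero_of_conv_lact hconv hφ0 h _ fun ξ => ?_
    rw [← hL, ← hΦ, hγ]
    rfl
  · refine Subtype.ext (Prod.ext (LinearMap.ext fun ξ => hinj ?_)
      (MulOpposite.unop_injective (LinearMap.ext fun ξ => hinj ?_)))
    · change Submodule.inclusion h (L _ _) = Submodule.inclusion h (L _ (L _ _))
      rw [hL, hL, hL, hassoc]
    · change Submodule.inclusion h (R _ _) = Submodule.inclusion h (R _ (R _ _))
      rw [hR, hR, hR, hassoc]
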